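/- Fix $\tau\in\mathbb C$ with $\operatorname{im}\tau>0$, put $q=e^{2\pi i\tau}$, and let $$\theta(x)=2q^{1/8}\sin(\pi x)\prod_{n\ge1}(1-q^n)(1-q^ne^{2\pi ix})(1-q^ne^{-2\pi ix}),\qquad \delta(e^{2\pi ix},e^{2\pi iy})=\frac{\theta'(0)\,\theta(x+y)}{\theta(x)\,\theta(y)} .$$ Let $r\ge0$ and $m\ge2r$ be integers, and consider meromorphic functions on $(\mathbb C^*)^{m+r+2}$ in the variables $x_1,\dots,x_m,u,h,\mu_1,\dots,\mu_r$. Arguments of $\delta$ are written multiplicatively; in quadratic forms the variables are written additively. *Types.* For an integral linear form $L$ in the variables, $\theta(L)$ has type $\tfrac12L^2$; types add under products and are negated under inverses; constants have type $0$. A combination of products of functions $\theta(L)^{\pm1}$ is pure of type $Q$ if all its summands have the same type $Q$ (as formal summands, so that the type makes sense also if the combination represents the zero function). A function represented by a combination that is pure of type $Q$ is a section of the line bundle of $Q$: with $a\cdot b=Q(a+b)-Q(a)-Q(b)$ it satisfies, in additive coordinates $z$, $$f(z+k+\ell\tau)=(-1)^{k\cdot k}(-q^{-1/2})^{\ell\cdot\ell}e^{-2\pi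 i\,\ell\cdot z}f(z)\qquad\text{for all integral vectors }k,\ell .$$ *Operations.* For $1\le i<m$ and a nontrivial character $\nu$ in the variables $h,\mu_1,\dots,\mu_r$ put $$\mathfrak C_i^\nu(f)=\delta\big(\tfrac{x_{i+1}}{x_i},\nu\big)f+\delta\big(\tfrac{x_i}{x_{i+1}},h\big)\,s_if ,$$ where $s_i$ exchanges $x_i$ and $x_{i+1}$. Let $$f=\mathcal E\ell\ell(\mathcal P^{\min}_{m,r})=\prod_{i=1}^r\Big(\delta\big(u\tfrac{x_i}{x_{m-r+i}},\mu_i\big)\prod_{j=m-r+i+1}^m\delta\big(u\tfrac{x_i}{x_j},h\big)\Big)$$ and $\rho_m=-\sum_{i=1}^m i\,x_i$. **Statement.** Let $w\in\mathfrak S_m$ and let $s_{i_1}s_{i_2}\cdots s_{i_\ell}$ be a reduced word of $w$. Then there are unique characters $\nu_1,\dots,\nu_\ell$ in the variables $h,\mu_1,\dots,\mu_r$ such that $\mathfrak C_{i_k}^{\nu_k}\mathfrak C_{i_{k+1}}^{\nu_{k+1}}\cdots\mathfrak C_{i_\ell}^{\nu_\ell}(f)$ is pure for every $k=1,\dots,\ell$.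 None of the $\nu_k$ is the trivial character, so the composition $$\mathfrak C_w^\diamond(f)=\mathfrak C_{i_1}^{\nu_1}\mathfrak C_{i_2}^{\nu_2}\cdots\mathfrak C_{i_\ell}^{\nu_\ell}(f)$$ is a well defined meromorphic function; it depends only on $w$ and not on the reduced word. Moreover, the type of $f$ can be written as $$\operatorname{type}(f)=q_x+\rho_mh+q_\mu,\qquad q_x=\sum_{i=1}^m\alpha_ix_i,$$ with $\alpha_i$ and $q_\mu$ not involving the variables $x_1,\dots,x_m$, and for every such decomposition $$\operatorname{type}\big(\mathfrak C_w^\diamond(f)\big)=w(q_x)+\rho_mh+q_\mu,\qquad w(q_x)=\sum_{i=1}^m\alpha_ix_{w(i)} .$$ -/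

import Mathlib

namespace LinkPattern

open Topology

/-! ### Variables, characters, permutations

All functions are written in additive (logarithmic) coordinates: a point of the torus
`(ℂ*)^(m+r+2)` is `exp (2πi p)` with `p : Var m r → ℂ`, and a character of the torus is
an integral linear form in the coordinates of `p`. -/

/-- The variables `x_1, …, x_m`, `u`, `h`, `μ_1, …, μ_r` (the indices are shifted to start at 0). -/
inductive Var (m r : ℕ) : Type where
  | x (i : Fin m)
  | u
  | h
  | mu (j : Fin r)
  deriving DecidableEq, Fintype

variable {m r : ℕ}

/-- Characters of the torus, written additively. -/
abbrev Character (m r : ℕ) := Var m r → ℤ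

/-- The coordinate character of a variable. -/
def coord (v : Var m r) : Character m r := Pi.single v 1

/-- The value of the linear form `L` at the point `p`. -/
noncomputable def Character.value (L : Character m r) (p : Var m r → ℂ) : ℂ :=
  ∑ v, (L v : ℂ) * p v

/-- The linear form `L` as a polynomial. -/
noncomputable def Character.toPoly (L : Character m r) : MvPolynomial (Var m r) ℚ :=
  ∑ v, MvPolynomial.C (L v : ℚ) * MvPolynomial.X v

/-- `L` is a character in the variables `h, μ_1, …, μ_r` only; these are the possible
parameters of the elliptic Demazure operations. -/
def Character.IsParameter (L : Character m r) : Prop :=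
  (∀ i, L (Var.x i) = 0) ∧ L Var.u = 0

/-- A permutation of `{1, …, m}` acts on the variables `x_i` and fixes all the others. -/
def permVar (w : Equiv.Perm (Fin m)) : Var m r → Var m r
  | Var.x i => Var.x (w i)
  | Var.u => Var.u
  | Var.h => Var.h
  | Var.mu j => Var.mu j

/-- The position `i` (of the pair `i, i + 1`) belonging to the `i`-th simple reflection. -/
def lowIdx (i : Fin (m - 1)) : Fin m := ⟨i.1, by have := i.2; omega⟩

/-- The position `i + 1` (of the pair `i, i + 1`) belonging to the `i`-th simple reflection. -/
def highIdx (i : Fin (m - 1)) : Fin m := ⟨i.1 + 1, by have := i.2; omega⟩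

/-- The simple reflection `s_i`, which exchanges `i` and `i + 1`. -/
def simpleRefl (i : Fin (m - 1)) : Equiv.Perm (Fin m) := Equiv.swap (lowIdx i) (highIdx i)

/-- The permutation `s_{i_1} s_{i_2} ⋯ s_{i_ℓ}` represented by a word. -/
def wordProd (l : List (Fin (m - 1))) : Equiv.Perm (Fin m) := (l.map simpleRefl).prod

/-- `l` is a reduced word of `w`: it represents `w` and no shorter word does. -/
def IsReducedWord (l : List (Fin (m - 1))) (w : Equiv.Perm (Fin m)) : Prop :=
  wordProd l = w ∧ ∀ l' : List (Fin (m - 1)), wordProd l' = w → l.length ≤ l'.length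

/-! ### Theta functions -/

/-- Jacobi's theta function
`θ_τ(x) = 2 q^(1/8) sin(πx) ∏_{n ≥ 1} (1 - q^n)(1 - q^n e^(2πix))(1 - q^n e^(-2πix))`,
`q = e^(2πiτ)`. -/
noncomputable def theta (τ x : ℂ) : ℂ :=
  2 * Complex.exp (2 * Real.pi * Complex.I * τ / 8) * Complex.sin (Real.pi * x) *
    ∏' n : ℕ, ((1 - Complex.exp (2 * Real.pi * Complex.I * τ) ^ (n + 1)) *
      (1 - Complex.exp (2 * Real.pi * Complex.I * τ) ^ (n + 1) *
        Complex.exp (2 * Real.pi * Complex.I * x)) *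
      (1 - Complex.exp (2 * Real.pi * Complex.I * τ) ^ (n + 1) *
        Complex.exp (-(2 * Real.pi * Complex.I * x))))

/-- `δ(e^(2πix), e^(2πiy)) = F_τ(x, y) = θ'(0) θ(x + y) / (θ(x) θ(y))`. -/
noncomputable def delta (τ x y : ℂ) : ℂ :=
  deriv (theta τ) 0 * theta τ (x + y) / (theta τ x * theta τ y)

/-! ### Elliptic Demazure operations on functions -/

/-- The operation
`C_i^ν(f) = δ(x_{i+1}/x_i, ν) f + δ(x_i/x_{i+1}, h) s_i f`, where `s_i` acts on the
`x`-variables. -/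
noncomputable def demazure (τ : ℂ) (i : Fin (m - 1)) (ν : Character m r)
    (f : (Var m r → ℂ) → ℂ) : (Var m r → ℂ) → ℂ := fun p =>
  delta τ (p (Var.x (highIdx i)) - p (Var.x (lowIdx i))) (ν.value p) * f p +
    delta τ (p (Var.x (lowIdx i)) - p (Var.x (highIdx i))) (p Var.h) *
      f (p ∘ permVar (simpleRefl i))

/-- The composition `C_{i_1}^{ν_1} C_{i_2}^{ν_2} ⋯ C_{i_ℓ}^{ν_ℓ}(f)`
(used for lists of equal length). -/
noncomputable def demazureWord (τ : ℂ) :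
    List (Fin (m - 1)) → List (Character m r) → ((Var m r → ℂ) → ℂ) → ((Var m r → ℂ) → ℂ)
  | i :: l, ν :: νs, f => demazure τ i ν (demazureWord τ l νs f)
  | _, _, f => f

/-- A function on `ℂ^(m+r+2)` is meromorphic: near every point it is a quotient `a / b` of
analytic functions with `b` not identically zero, off the zeros of `b`. -/
def IsMeromorphic (f : (Var m r → ℂ) → ℂ) : Prop :=
  ∀ p, ∃ a b : (Var m r → ℂ) → ℂ, AnalyticAt ℂ a p ∧ AnalyticAt ℂ b p ∧
    (∃ᶠ z in 𝓝 p, b z ≠ 0) ∧ ∀ᶠ z in 𝓝 p, b z ≠ 0 → f z = a z / b z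

/-- Two functions agree as meromorphic functions: they agree on a dense open set. -/
def MeroEq (f g : (Var m r → ℂ) → ℂ) : Prop :=
  ∃ U : Set (Var m r → ℂ), IsOpen U ∧ Dense U ∧ Set.EqOn f g U

/-! ### Combinations of products of theta functions and their types -/

/-- Combinations of products of theta functions `θ(L)` and their inverses `θ(L)⁻¹`,
where `L` is a character. -/
inductive ThetaExpr (m r : ℕ) : Type where
  | const (c : ℂ)
  | theta (L : Character m r)
  | thetaInv (L : Character m r)
  | mul (a b : ThetaExpr m r)
  | add (a b : ThetaExpr m r)

namespace ThetaExpr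

/-- The function represented by a combination. -/
noncomputable def eval (τ : ℂ) : ThetaExpr m r → (Var m r → ℂ) → ℂ
  | const c, _ => c
  | theta L, p => LinkPattern.theta τ (L.value p)
  | thetaInv L, p => (LinkPattern.theta τ (L.value p))⁻¹
  | mul a b, p => eval τ a p * eval τ b p
  | add a b, p => eval τ a p + eval τ b p

/-- The combination is pure of type `Q` (a quadratic form): `θ(L)` has type `L²/2`, products
add types, inverses negate them, and in a sum all summands must have the same type. -/
def HasType : ThetaExpr m r → MvPolynomial (Var m r) ℚ → Prop
  | const _, Q => Q = 0
  | theta L, Q => Q = MvPolynomial.C (1 / 2) * L.toPoly ^ 2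
  | thetaInv L, Q => Q = -(MvPolynomial.C (1 / 2) * L.toPoly ^ 2)
  | mul a b, Q => ∃ Q₁ Q₂, HasType a Q₁ ∧ HasType b Q₂ ∧ Q = Q₁ + Q₂
  | add a b, Q => HasType a Q ∧ HasType b Q

/-- The combination is pure: all its summands have the same type. -/
def IsPure (e : ThetaExpr m r) : Prop := ∃ Q, e.HasType Q

/-- The action of a permutation of the `x`-variables. -/
def perm (w : Equiv.Perm (Fin m)) : ThetaExpr m r → ThetaExpr m r
  | const c => const c
  | theta L => theta (L ∘ permVar w⁻¹)
  | thetaInv L => thetaInv (L ∘ permVar w⁻¹)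
  | mul a b => mul (perm w a) (perm w b)
  | add a b => add (perm w a) (perm w b)

/-- `δ(K, L) = θ'(0) θ(K + L) θ(K)⁻¹ θ(L)⁻¹` for two characters `K, L`. -/
noncomputable def delta (τ : ℂ) (K L : Character m r) : ThetaExpr m r :=
  mul (const (deriv (LinkPattern.theta τ) 0))
    (mul (theta (K + L)) (mul (thetaInv K) (thetaInv L)))

/-- The operation `C_i^ν` on combinations of products of theta functions. -/
noncomputable def demazure (τ : ℂ) (i : Fin (m - 1)) (ν : Character m r) (e : ThetaExpr m r) :
    ThetaExpr m r :=
  add (mul (delta τ (coord (Var.x (highIdx i)) - coord (Var.x (lowIdx i))) ν) e)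
    (mul (delta τ (coord (Var.x (lowIdx i)) - coord (Var.x (highIdx i))) (coord Var.h))
      (perm (simpleRefl i) e))

/-- The composition `C_{i_1}^{ν_1} ⋯ C_{i_ℓ}^{ν_ℓ}` on combinations of products of theta
functions (used for lists of equal length). -/
noncomputable def demazureWord (τ : ℂ) :
    List (Fin (m - 1)) → List (Character m r) → ThetaExpr m r → ThetaExpr m r
  | i :: l, ν :: νs, e => demazure τ i ν (demazureWord τ l νs e)
  | _, _, e => e

/-- The parameters `ν_1, …, ν_ℓ` are admissible for the word `i_1, …, i_ℓ` and the
combination `e`: for every `k` the parameter `ν_k` is a character in `h, μ_1, …, μ_r`, and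
`C_{i_k}^{ν_k} C_{i_{k+1}}^{ν_{k+1}} ⋯ C_{i_ℓ}^{ν_ℓ}(e)` is pure. -/
def Admissible (τ : ℂ) :
    List (Fin (m - 1)) → List (Character m r) → ThetaExpr m r → Prop
  | [], [], _ => True
  | i :: l, ν :: νs, e =>
      Admissible τ l νs e ∧ ν.IsParameter ∧ (demazureWord τ (i :: l) (ν :: νs) e).IsPure
  | _, _, _ => False

/-- The product of a list of combinations. -/
noncomputable def listProd (es : List (ThetaExpr m r)) : ThetaExpr m r :=
  es.foldr mul (const 1)

end ThetaExpr

/-- The position `i ≤ r` as an element of `{1, …, m}`: the target of the `i`-th arrow of the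
minimal link pattern. -/
def targetIdx (hmr : 2 * r ≤ m) (i : Fin r) : Fin m := ⟨i.1, by have := i.2; omega⟩

/-- The position `m - r + i`: the source of the `i`-th arrow of the minimal link pattern. -/
def sourceIdx (hmr : 2 * r ≤ m) (i : Fin r) : Fin m := ⟨m - r + i.1, by have := i.2; omega⟩

/-- The elliptic class of the minimal link pattern of size `m` and rank `r`:
`∏_{i=1}^r ( δ(u x_i / x_{m-r+i}, μ_i) ∏_{j=m-r+i+1}^m δ(u x_i / x_j, h) )`. -/
noncomputable def ellMin (τ : ℂ) (hmr : 2 * r ≤ m) : ThetaExpr m r :=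
  ThetaExpr.listProd ((List.finRange r).map fun i =>
    ThetaExpr.mul
      (ThetaExpr.delta τ
        (coord Var.u + coord (Var.x (targetIdx hmr i)) - coord (Var.x (sourceIdx hmr i)))
        (coord (Var.mu i)))
      (ThetaExpr.listProd (((List.finRange m).filter (fun j => sourceIdx hmr i < j)).map fun j =>
        ThetaExpr.delta τ
          (coord Var.u + coord (Var.x (targetIdx hmr i)) - coord (Var.x j))
          (coord Var.h))))

/-! ### Types and line bundles -/

/-- The polynomial does not involve the variables `x_i`. -/
def FreeOfX (Q : MvPolynomial (Var m r) ℚ) : Prop := ∀ i, Var.x i ∉ Q.vars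

/-- `ρ_m = - ∑ i x_i`, the sum over `i = 1, …, m`. -/
noncomputable def rho (m r : ℕ) : MvPolynomial (Var m r) ℚ :=
  -∑ i : Fin m, MvPolynomial.C ((i.1 : ℚ) + 1) * MvPolynomial.X (Var.x i)

/-- The value of a quadratic form at a point. -/
noncomputable def qval (Q : MvPolynomial (Var m r) ℚ) (z : Var m r → ℂ) : ℂ :=
  MvPolynomial.aeval z Q

/-- `f` transforms as a section of the line bundle of the quadratic form `Q` on the product of
elliptic curves `ℂ/⟨1, τ⟩`: with the bilinear form `a · b = Q(a + b) - Q(a) - Q(b)` (so that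
`a · a = 2 Q(a)`) and `q = e^(2πiτ)`,
`f(z + k + ℓτ) = (-1)^(k·k) (-1)^(ℓ·ℓ) q^(-ℓ·ℓ/2) e^(-2πi ℓ·z) f(z)`
for all integral vectors `k, ℓ`. -/
def IsSection (τ : ℂ) (f : (Var m r → ℂ) → ℂ) (Q : MvPolynomial (Var m r) ℚ) : Prop :=
  ∀ (k l : Var m r → ℤ) (z : Var m r → ℂ),
    f (fun v => z v + k v + l v * τ) =
      Complex.exp (2 * Real.pi * Complex.I *
        (qval Q (fun v => k v) + qval Q (fun v => l v) - τ * qval Q (fun v => l v) -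
          (qval Q (fun v => l v + z v) - qval Q (fun v => l v) - qval Q z))) * f z

/-! ### Compatibility of the operations on combinations and on functions -/

theorem value_coord (v : Var m r) (p : Var m r → ℂ) : (coord v).value p = p v := by
  simp [coord, Character.value, Pi.single_apply]

theorem value_add (K L : Character m r) (p : Var m r → ℂ) :
    (K + L : Character m r).value p = K.value p + L.value p := by
  simp [Character.value, add_mul, Finset.sum_add_distrib]

theorem value_sub (K L : Character m r) (p : Var m r → ℂ) :
    (K - L : Character m r).value p = K.value p - L.value p := by
  simp [Character.value, sub_mul, Finset.sum_sub_distrib]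

theorem permVar_inv_apply (w : Equiv.Perm (Fin m)) (v : Var m r) :
    permVar w⁻¹ (permVar w v) = v := by
  cases v <;> simp [permVar]

theorem permVar_apply_inv (w : Equiv.Perm (Fin m)) (v : Var m r) :
    permVar w (permVar w⁻¹ v) = v := by
  cases v <;> simp [permVar]

theorem value_comp_permVar (w : Equiv.Perm (Fin m)) (L : Character m r) (p : Var m r → ℂ) :
    Character.value (L ∘ permVar w⁻¹) p = L.value (p ∘ permVar w) := by
  unfold Character.value
  refine Finset.sum_bij' (fun v _ => permVar w⁻¹ v) (fun v _ => permVar w v) ?_ ?_ ?_ ?_ ?_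
  · simp
  · simp
  · intro v _; exact permVar_apply_inv w v
  · intro v _; exact permVar_inv_apply w v
  · intro v _; simp [permVar_apply_inv]

theorem ThetaExpr.eval_perm (τ : ℂ) (w : Equiv.Perm (Fin m)) (e : ThetaExpr m r)
    (p : Var m r → ℂ) : (e.perm w).eval τ p = e.eval τ (p ∘ permVar w) := by
  induction e with
  | const c => rfl
  | theta L => simp only [ThetaExpr.perm, ThetaExpr.eval, value_comp_permVar]
  | thetaInv L => simp only [ThetaExpr.perm, ThetaExpr.eval, value_comp_permVar]
  | mul a b iha ihb => simp only [ThetaExpr.perm, ThetaExpr.eval, iha, ihb]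
  | add a b iha ihb => simp only [ThetaExpr.perm, ThetaExpr.eval, iha, ihb]

theorem ThetaExpr.eval_delta (τ : ℂ) (K L : Character m r) (p : Var m r → ℂ) :
    (ThetaExpr.delta τ K L).eval τ p = LinkPattern.delta τ (K.value p) (L.value p) := by
  simp only [ThetaExpr.delta, ThetaExpr.eval, LinkPattern.delta, value_add, div_eq_mul_inv,
    mul_inv, mul_assoc]

theorem ThetaExpr.eval_demazure (τ : ℂ) (i : Fin (m - 1)) (ν : Character m r)
    (e : ThetaExpr m r) :
    (e.demazure τ i ν).eval τ = LinkPattern.demazure τ i ν (e.eval τ) := by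
  funext p
  simp only [ThetaExpr.demazure, ThetaExpr.eval, ThetaExpr.eval_delta, ThetaExpr.eval_perm,
    LinkPattern.demazure, value_sub, value_coord]

theorem ThetaExpr.eval_demazureWord (τ : ℂ) (l : List (Fin (m - 1)))
    (νs : List (Character m r)) (e : ThetaExpr m r) :
    (ThetaExpr.demazureWord τ l νs e).eval τ = LinkPattern.demazureWord τ l νs (e.eval τ) := by
  induction l generalizing νs with
  | nil => cases νs <;> rfl
  | cons i l ih =>
    cases νs with
    | nil => rfl
    | cons ν νs =>
      simp only [ThetaExpr.demazureWord, LinkPattern.demazureWord, ThetaExpr.eval_demazure, ih]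

end LinkPattern

/-! Types. The combination δ(K, L) has type KL. Suppose e has type Q = Σ α_k x_{w(k)} + ρ_m h + q.
The two summands of C_i^ν(e) then have types (x_{i+1} - x_i)ν + Q and (x_i - x_{i+1})h + s_i Q.
Since s_i ρ_m = ρ_m + x_{i+1} - x_i, the multiples of h cancel in the second one, which becomes the
same expression with w replaced by s_i w. The first agrees with it exactly when ν = α_{w⁻¹(i)} -
α_{w⁻¹(i+1)}. By induction purity determines every parameter and the type of the result
(`hasType_demazure_twistedType_iff`).

Nontriviality. For the minimal link pattern the characters α_k are pairwise distinct
(`alphaChar_injective`): μ_k occurs with coefficient 1 at the target and -1 at the source of the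
k-th arrow and nowhere else, and at the vertices without arrow the coefficient of h is the position.
Hence no θ(0)⁻¹ ever occurs, and the result is a quotient of analytic functions. It is a section of
the line bundle of its type because the exponent of the multiplier is linear in the type.

Independence of the word. By the theorem of Matsumoto and Tits it suffices to check the two kinds of
braid moves. Operations with distant indices commute. For neighbours i, j = i + 1 the parameters
occur as a, a + b, b on one side and b, a + b, a on the other, and the relation is C_i^b C_j^{a+b}
C_i^a = C_j^a C_i^{a+b} C_j^b. Comparing the coefficients of the six translates of f leaves three
identities between products of δ: two instances of Fay's trisecant identity (`delta_three_term`) and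
one identity of degree three (`delta_braid`). All of them come from Weierstrass' three-term
identity, which holds because the functions z ↦ θ(a + z)θ(a - z) lie in a space of dimension at most
two: a Fourier coefficient recursion of step two shows this. The relation holds off the zeros of
finitely many θ(L) with L ≠ 0, that is, on a dense open set. -/

namespace LinkPattern

open Topology

variable {m r : ℕ}

/-! ### The theta function -/

/-- The infinite product `∏_{n ≥ 0} (1 - q^n w)`. -/
noncomputable def qProd (q w : ℂ) : ℂ := ∏' n : ℕ, (1 - q ^ n * w)

theorem multipliable_qProd {q : ℂ} (hq : ‖q‖ < 1) (w : ℂ) :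
    Multipliable fun n : ℕ => 1 - q ^ n * w := by
  simp_rw [sub_eq_add_neg]
  apply multipliable_one_add_of_summable
  simpa using (summable_geometric_of_lt_one (norm_nonneg _) hq).mul_right ‖w‖

theorem tprod_succ_eq_qProd (q w : ℂ) :
    ∏' n : ℕ, (1 - q ^ (n + 1) * w) = qProd q (q * w) := by
  unfold qProd
  exact tprod_congr fun n => by ring

/-- Splits off the factor n = 0. This functional equation is what produces the behaviour of θ under
translation by τ. -/
theorem qProd_eq_mul {q : ℂ} (hq : ‖q‖ < 1) (w : ℂ) :
    qProd q w = (1 - w) * qProd q (q * w) := by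
  have h : Multipliable fun n : ℕ => 1 - q ^ (n + 1) * w :=
    (multipliable_qProd hq (q * w)).congr fun n => by ring
  have h2 := tprod_eq_zero_mul' (f := fun n : ℕ => 1 - q ^ n * w) h
  rw [pow_zero, one_mul] at h2
  rw [← tprod_succ_eq_qProd]
  exact h2

theorem qProd_ne_zero {q w : ℂ} (hq : ‖q‖ < 1) (h : ∀ n : ℕ, q ^ n * w ≠ 1) :
    qProd q w ≠ 0 := by
  unfold qProd
  simp_rw [sub_eq_add_neg]
  apply tprod_one_add_ne_zero_of_summable
  · intro n hn
    exact h n (by linear_combination -hn)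
  · simpa using (summable_geometric_of_lt_one (norm_nonneg _) hq).mul_right ‖w‖

/-- On each ball of radius R the product converges locally uniformly, with majorant R‖q‖ⁿ. -/
theorem differentiable_qProd {q : ℂ} (hq : ‖q‖ < 1) : Differentiable ℂ (qProd q) := by
  have key : ∀ R : ℝ, DifferentiableOn ℂ (qProd q) (Metric.ball 0 R) := by
    intro R
    have h := Summable.hasProdLocallyUniformlyOn_nat_one_add (K := Metric.ball (0 : ℂ) R)
      (f := fun n w => -(q ^ n * w)) Metric.isOpen_ball
      ((summable_geometric_of_lt_one (norm_nonneg q) hq).mul_right R)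
      (.of_forall fun n w hw => by
        have : ‖w‖ ≤ R := by simpa using (Metric.mem_ball.1 hw).le
        simpa using mul_le_mul_of_nonneg_left this (by positivity))
      (fun n => by fun_prop)
    have h2 := h.differentiableOn (.of_forall fun s => by
        simpa [Finset.prod_fn] using! DifferentiableOn.finsetProd (fun _ _ ↦ by fun_prop))
        Metric.isOpen_ball
    refine h2.congr fun w _ => ?_
    simp [qProd, sub_eq_add_neg]
  intro w
  exact (key (‖w‖ + 1)).differentiableAt (Metric.isOpen_ball.mem_nhds (by simp))

/-- The nome `q = e^(2πiτ)`. -/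
noncomputable def nome (τ : ℂ) : ℂ := Complex.exp (2 * Real.pi * Complex.I * τ)

theorem norm_nome_lt_one {τ : ℂ} (hτ : 0 < τ.im) : ‖nome τ‖ < 1 :=
  UpperHalfPlane.norm_exp_two_pi_I_lt_one ⟨τ, hτ⟩

theorem theta_eq_sin_mul {τ : ℂ} (hτ : 0 < τ.im) (x : ℂ) :
    theta τ x = 2 * Complex.exp (2 * Real.pi * Complex.I * τ / 8) * qProd (nome τ) (nome τ) *
      (Complex.sin (Real.pi * x) *
        (qProd (nome τ) (nome τ * Complex.exp (2 * Real.pi * Complex.I * x)) *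
        qProd (nome τ) (nome τ * Complex.exp (-(2 * Real.pi * Complex.I * x))))) := by
  have hq := norm_nome_lt_one hτ
  have hm : ∀ w, Multipliable fun n : ℕ => 1 - nome τ ^ (n + 1) * w := fun w => by
    simpa [pow_succ, mul_assoc] using multipliable_qProd hq (nome τ * w)
  have h1 : Multipliable fun n : ℕ => 1 - nome τ ^ (n + 1) := by simpa using hm 1
  have e1 : ∏' n : ℕ, (1 - nome τ ^ (n + 1)) = qProd (nome τ) (nome τ) := by
    simpa using tprod_succ_eq_qProd (nome τ) 1
  unfold theta
  change _ * ∏' n : ℕ, ((1 - nome τ ^ (n + 1)) * (1 - nome τ ^ (n + 1) * _) *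
    (1 - nome τ ^ (n + 1) * _)) = _
  rw [(h1.mul (hm _)).tprod_mul (hm _), h1.tprod_mul (hm _), e1, tprod_succ_eq_qProd,
    tprod_succ_eq_qProd]
  ring

/-- The sine supplies the missing factor 1 - e^(-2πix) of the second product. In this form
translation by τ moves a single factor from one product to the other. -/
theorem theta_eq_exp_mul {τ : ℂ} (hτ : 0 < τ.im) (x : ℂ) :
    theta τ x = 2 * Complex.exp (2 * Real.pi * Complex.I * τ / 8) * qProd (nome τ) (nome τ) *
      (-Complex.I / 2 * Complex.exp (Real.pi * Complex.I * x) *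
        (qProd (nome τ) (nome τ * Complex.exp (2 * Real.pi * Complex.I * x)) *
        qProd (nome τ) (Complex.exp (-(2 * Real.pi * Complex.I * x))))) := by
  rw [theta_eq_sin_mul hτ, qProd_eq_mul (norm_nome_lt_one hτ)
    (Complex.exp (-(2 * Real.pi * Complex.I * x)))]
  have h : Complex.sin (Real.pi * x) = -Complex.I / 2 * Complex.exp (Real.pi * Complex.I * x) *
      (1 - Complex.exp (-(2 * Real.pi * Complex.I * x))) := by
    have h2 : Complex.exp (Real.pi * Complex.I * x) *
        Complex.exp (-(2 * Real.pi * Complex.I * x)) = Complex.exp (-(Real.pi * x) * Complex.I) := by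
      rw [← Complex.exp_add]; congr 1; ring
    rw [Complex.sin, ← h2, show (Real.pi : ℂ) * x * Complex.I = Real.pi * Complex.I * x by ring]
    ring
  rw [h]
  ring

theorem theta_neg {τ : ℂ} (hτ : 0 < τ.im) (x : ℂ) : theta τ (-x) = -theta τ x := by
  rw [theta_eq_sin_mul hτ, theta_eq_sin_mul hτ]
  simp only [mul_neg, Complex.sin_neg, neg_neg]
  ring

theorem theta_add_one {τ : ℂ} (hτ : 0 < τ.im) (x : ℂ) : theta τ (x + 1) = -theta τ x := by
  have h : Complex.exp (2 * Real.pi * Complex.I * (x + 1)) =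
      Complex.exp (2 * Real.pi * Complex.I * x) := by
    rw [mul_add, mul_one, Complex.exp_periodic]
  rw [theta_eq_sin_mul hτ, theta_eq_sin_mul hτ, Complex.exp_neg, h, ← Complex.exp_neg, mul_add,
    mul_one, Complex.sin_add_pi]
  ring

theorem theta_add_tau {τ : ℂ} (hτ : 0 < τ.im) (x : ℂ) :
    theta τ (x + τ) =
      -Complex.exp (-(Real.pi * Complex.I * τ) - 2 * Real.pi * Complex.I * x) * theta τ x := by
  have hq := norm_nome_lt_one hτ
  have hn : nome τ ≠ 0 := Complex.exp_ne_zero _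
  rw [theta_eq_exp_mul hτ, theta_eq_exp_mul hτ]
  set w := Complex.exp (2 * Real.pi * Complex.I * x) with hw
  have hw0 : w ≠ 0 := Complex.exp_ne_zero _
  have e1 : Complex.exp (2 * Real.pi * Complex.I * (x + τ)) = nome τ * w := by
    rw [hw, nome, ← Complex.exp_add]; congr 1; ring
  have e2 : Complex.exp (-(2 * Real.pi * Complex.I * x)) = w⁻¹ := by rw [Complex.exp_neg]
  have e3 : Complex.exp (-(2 * Real.pi * Complex.I * (x + τ))) = (nome τ)⁻¹ * w⁻¹ := by
    rw [Complex.exp_neg, e1, mul_inv]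
  have e4 : Complex.exp (Real.pi * Complex.I * (x + τ)) =
      nome τ * w * (Complex.exp (-(Real.pi * Complex.I * τ) - 2 * Real.pi * Complex.I * x) *
        Complex.exp (Real.pi * Complex.I * x)) := by
    rw [hw, nome, ← Complex.exp_add, ← Complex.exp_add, ← Complex.exp_add]; congr 1; ring
  have f1 := qProd_eq_mul hq (nome τ * w)
  have f2 := qProd_eq_mul hq ((nome τ)⁻¹ * w⁻¹)
  rw [mul_inv_cancel_left₀ hn] at f2
  -- With nome q, the sign of the multiplier comes from qw(1 - (qw)⁻¹) = -(1 - qw).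
  rw [e1, e2, e3, e4, f1, f2]
  field_simp
  ring

theorem differentiable_theta {τ : ℂ} (hτ : 0 < τ.im) : Differentiable ℂ (theta τ) := by
  have h : theta τ = fun x => _ := funext (theta_eq_sin_mul hτ)
  have hq := differentiable_qProd (norm_nome_lt_one hτ)
  rw [h]
  have h1 : Differentiable ℂ fun x : ℂ =>
      qProd (nome τ) (nome τ * Complex.exp (2 * Real.pi * Complex.I * x)) :=
    hq.comp (by fun_prop)
  have h2 : Differentiable ℂ fun x : ℂ =>
      qProd (nome τ) (nome τ * Complex.exp (-(2 * Real.pi * Complex.I * x))) :=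
    hq.comp (by fun_prop)
  fun_prop

/-- At 1/2 the sine is 1, and the remaining factors are 1 - qⁿw with ‖w‖ = 1 and n ≥ 1. The point
serves as witness that θ is not identically zero. -/
theorem theta_half_ne_zero {τ : ℂ} (hτ : 0 < τ.im) : theta τ (1 / 2) ≠ 0 := by
  have hq := norm_nome_lt_one hτ
  have key : ∀ w : ℂ, ‖w‖ = 1 → qProd (nome τ) (nome τ * w) ≠ 0 := by
    intro w hw
    refine qProd_ne_zero hq fun n hn => ?_
    have h2 : ‖nome τ‖ ^ (n + 1) = 1 := by
      have := congrArg norm hn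
      simpa [hw, pow_succ] using this
    exact (pow_lt_one₀ (norm_nonneg _) hq n.succ_ne_zero).ne h2
  have hexp : ∀ y : ℝ, ‖Complex.exp (y * Complex.I)‖ = 1 := Complex.norm_exp_ofReal_mul_I
  rw [theta_eq_sin_mul hτ]
  refine mul_ne_zero (mul_ne_zero (mul_ne_zero two_ne_zero (Complex.exp_ne_zero _)) ?_)
    (mul_ne_zero ?_ (mul_ne_zero (key _ ?_) (key _ ?_)))
  · simpa using key 1 (by simp)
  · rw [show (Real.pi : ℂ) * (1 / 2) = Real.pi / 2 by ring, Complex.sin_pi_div_two]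
    exact one_ne_zero
  · rw [← hexp Real.pi]; congr 2; ring
  · rw [← hexp (-Real.pi)]; congr 2; push_cast; ring

theorem dense_theta_ne_zero {τ : ℂ} (hτ : 0 < τ.im) : Dense {x | theta τ x ≠ 0} := by
  have ha : AnalyticOnNhd ℂ (theta τ) Set.univ :=
    (differentiable_theta hτ).differentiableOn.analyticOnNhd isOpen_univ
  intro x
  by_contra hx
  have h0 : theta τ =ᶠ[𝓝 x] 0 := by
    rw [mem_closure_iff_frequently, Filter.not_frequently] at hx
    filter_upwards [hx] with y hy
    simpa using hy
  have := ha.eqOn_zero_of_preconnected_of_eventuallyEq_zero isPreconnected_univ (Set.mem_univ x) h0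
  exact theta_half_ne_zero hτ (this (Set.mem_univ _))

/-! ### Theta functions of degree two and the three-term identity -/

/-- The real part of w is removed by periodicity on the real line, the imaginary part by Cauchy's
theorem on a rectangle of width 1, whose vertical sides cancel. -/
theorem integral_periodic_add_eq {g : ℂ → ℂ} (hg : Differentiable ℂ g)
    (hp : ∀ z, g (z + 1) = g z) (w : ℂ) :
    ∫ x in (0 : ℝ)..1, g (x + w) = ∫ x in (0 : ℝ)..1, g x := by
  have hre : ∫ x in (0 : ℝ)..1, g (x + w) = ∫ x in (0 : ℝ)..1, g (x + w.im * Complex.I) := by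
    have hper : Function.Periodic (fun x : ℝ => g (x + w.im * Complex.I)) 1 := fun x => by
      simp only [Complex.ofReal_add, Complex.ofReal_one]
      rw [add_right_comm, hp]
    have h1 := hper.intervalIntegral_add_eq w.re 0
    have h2 := intervalIntegral.integral_comp_add_right (a := 0) (b := 1)
      (fun x : ℝ => g (x + w.im * Complex.I)) w.re
    rw [zero_add, add_comm (1 : ℝ)] at h2
    rw [zero_add, ← h2] at h1
    rw [← h1]
    refine intervalIntegral.integral_congr fun x _ => ?_
    congr 1
    rw [Complex.ofReal_add, add_assoc, Complex.re_add_im]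
  have h := Complex.integral_boundary_rect_eq_zero_of_differentiableOn g 0 (1 + w.im * Complex.I)
    hg.differentiableOn
  have hv : ∫ y in (0 : ℝ)..w.im, g (1 + y * Complex.I) =
      ∫ y in (0 : ℝ)..w.im, g (y * Complex.I) :=
    intervalIntegral.integral_congr fun y _ => by
        rw [add_comm, hp]
  simp [hv] at h
  rw [hre]
  exact (sub_eq_zero.1 h).symm

/-- The Fourier coefficients of a function on the real line. -/
noncomputable def realFourierCoeff (f : ℂ → ℂ) (n : ℤ) : ℂ :=
  ∫ x in (0 : ℝ)..1, f x * Complex.exp (-(2 * Real.pi * Complex.I * n * x))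

theorem exp_int_add_one (n : ℤ) (z : ℂ) :
    Complex.exp (-(2 * Real.pi * Complex.I * n * (z + 1))) =
      Complex.exp (-(2 * Real.pi * Complex.I * n * z)) := by
  rw [show -(2 * (Real.pi : ℂ) * Complex.I * n * (z + 1)) =
    -(2 * Real.pi * Complex.I * n * z) + ((-n : ℤ) : ℂ) * (2 * Real.pi * Complex.I) by
      push_cast; ring]
  exact (Complex.exp_periodic.int_mul (-n)) _

/-- The contour is moved by τ in the integral of f(z)e^(-2πinz); the multiplier e^(-4πiz) raises the
frequency by two. -/
theorem realFourierCoeff_of_quasiperiodic {f : ℂ → ℂ} (hf : Differentiable ℂ f)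
    (hp : ∀ z, f (z + 1) = f z) {τ c : ℂ}
    (hq : ∀ z, f (z + τ) = c * Complex.exp (-(4 * Real.pi * Complex.I * z)) * f z) (n : ℤ) :
    realFourierCoeff f n = c * Complex.exp (-(2 * Real.pi * Complex.I * n * τ)) *
      realFourierCoeff f (n + 2) := by
  have h := integral_periodic_add_eq
    (g := fun z => f z * Complex.exp (-(2 * Real.pi * Complex.I * n * z)))
    (hf.mul (by fun_prop)) (fun z => by rw [hp, exp_int_add_one]) τ
  unfold realFourierCoeff
  rw [← h, ← intervalIntegral.integral_const_mul]
  refine intervalIntegral.integral_congr fun x _ => ?_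
  rw [hq]
  have e : Complex.exp (-(4 * Real.pi * Complex.I * x)) *
      Complex.exp (-(2 * Real.pi * Complex.I * n * (x + τ))) =
      Complex.exp (-(2 * Real.pi * Complex.I * n * τ)) *
      Complex.exp (-(2 * Real.pi * Complex.I * (n + 2 : ℤ) * x)) := by
    rw [← Complex.exp_add, ← Complex.exp_add]
    congr 1
    push_cast
    ring
  linear_combination c * f x * e

/-- The Fourier series of f on the circle is zero, so f vanishes on the real line, and then
everywhere by the identity theorem. -/
theorem eq_zero_of_realFourierCoeff {f : ℂ → ℂ} (hf : Differentiable ℂ f)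
    (hp : ∀ z, f (z + 1) = f z) (h0 : ∀ n, realFourierCoeff f n = 0) : f = 0 := by
  have hper : Function.Periodic (fun x : ℝ => f x) 1 := fun x => by
    simp only [Complex.ofReal_add, Complex.ofReal_one, hp]
  have hcont : Continuous fun x : ℝ => f x := hf.continuous.comp Complex.continuous_ofReal
  let F : C(AddCircle (1 : ℝ), ℂ) :=
    ⟨hper.lift, continuous_coinduced_dom.2 hcont⟩
  have hF : ∀ x : ℝ, F (x : AddCircle (1 : ℝ)) = f x := fun x => hper.lift_coe x
  have hcoef : fourierCoeff F = 0 := by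
    funext n
    rw [fourierCoeff_eq_intervalIntegral _ n 0, zero_add, Pi.zero_apply, one_div, inv_one, one_smul,
      ← h0 n]
    refine intervalIntegral.integral_congr fun x _ => ?_
    rw [hF, fourier_coe_apply, smul_eq_mul, mul_comm]
    congr 2
    push_cast
    ring
  have hreal : ∀ x : ℝ, f x = 0 := fun x => by
    have := has_pointwise_sum_fourier_series_of_summable (f := F)
      (by rw [hcoef]; exact summable_zero) (x : AddCircle (1 : ℝ))
    rw [hcoef, hF] at this
    simpa using this.unique (by simp)
  have ha : AnalyticOnNhd ℂ f Set.univ := hf.differentiableOn.analyticOnNhd isOpen_univ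
  have hfreq : ∃ᶠ z in 𝓝[≠] (0 : ℂ), f z = 0 := by
    have ht : Filter.Tendsto (fun x : ℝ => (x : ℂ)) (𝓝[≠] 0) (𝓝[≠] 0) := by
      refine tendsto_nhdsWithin_iff.2 ⟨?_, ?_⟩
      · exact (Complex.continuous_ofReal.tendsto' 0 0 rfl).mono_left nhdsWithin_le_nhds
      · filter_upwards [self_mem_nhdsWithin] with x hx
        simpa using hx
    exact ht.frequently (Filter.Frequently.of_forall hreal)
  funext z
  exact ha.eqOn_zero_of_preconnected_of_frequently_eq_zero isPreconnected_univ
    (Set.mem_univ 0) hfreq (Set.mem_univ z)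

/-- The recursion of step two spreads the vanishing of the coefficients 0 and 1 to all even and all
odd indices. So the theta functions of degree two with this multiplier form a space of dimension at
most two. -/
theorem eq_zero_of_quasiperiodic {f : ℂ → ℂ} (hf : Differentiable ℂ f)
    (hp : ∀ z, f (z + 1) = f z) {τ c : ℂ} (hc : c ≠ 0)
    (hq : ∀ z, f (z + τ) = c * Complex.exp (-(4 * Real.pi * Complex.I * z)) * f z)
    (h0 : realFourierCoeff f 0 = 0) (h1 : realFourierCoeff f 1 = 0) : f = 0 := by
  refine eq_zero_of_realFourierCoeff hf hp ?_
  have hrec := realFourierCoeff_of_quasiperiodic hf hp hq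
  have hiff : ∀ n, realFourierCoeff f n = 0 ↔ realFourierCoeff f (n + 2) = 0 := fun n => by
    rw [hrec n]
    simp [hc, Complex.exp_ne_zero]
  have key : ∀ n : ℤ, realFourierCoeff f n = 0 ∧ realFourierCoeff f (n + 1) = 0 := by
    intro n
    induction n using Int.induction_on with
    | zero => exact ⟨h0, h1⟩
    | succ i ih => exact ⟨ih.2, by rw [add_assoc]; exact (hiff _).1 ih.1⟩
    | pred i ih =>
      refine ⟨(hiff _).2 ?_, by simpa using ih.1⟩
      convert ih.2 using 2
      ring
  exact fun n => (key n).1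

/-- The function `θ(a + z) θ(a - z)`. -/
noncomputable def thetaPair (τ a z : ℂ) : ℂ := theta τ (a + z) * theta τ (a - z)

section ThetaPair

variable {τ : ℂ}

theorem thetaPair_swap (hτ : 0 < τ.im) (a z : ℂ) : thetaPair τ a z = -thetaPair τ z a := by
  rw [thetaPair, thetaPair, add_comm a, ← neg_sub z a, theta_neg hτ]
  ring

theorem differentiable_thetaPair (hτ : 0 < τ.im) (a : ℂ) : Differentiable ℂ (thetaPair τ a) := by
  have h := differentiable_theta hτ
  unfold thetaPair
  exact (h.comp (by fun_prop : Differentiable ℂ fun z => a + z)).mul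
    (h.comp (by fun_prop : Differentiable ℂ fun z => a - z))

theorem thetaPair_add_one (hτ : 0 < τ.im) (a z : ℂ) :
    thetaPair τ a (z + 1) = thetaPair τ a z := by
  rw [thetaPair_swap hτ, thetaPair_swap hτ a, thetaPair, thetaPair, add_right_comm,
    add_sub_right_comm, theta_add_one hτ, theta_add_one hτ]
  ring

theorem thetaPair_add_tau (hτ : 0 < τ.im) (a z : ℂ) :
    thetaPair τ a (z + τ) = Complex.exp (-(2 * Real.pi * Complex.I * τ)) *
      Complex.exp (-(4 * Real.pi * Complex.I * z)) * thetaPair τ a z := by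
  have e : Complex.exp (-(2 * Real.pi * Complex.I * τ)) *
      Complex.exp (-(4 * Real.pi * Complex.I * z)) =
      Complex.exp (-(Real.pi * Complex.I * τ) - 2 * Real.pi * Complex.I * (z + a)) *
      Complex.exp (-(Real.pi * Complex.I * τ) - 2 * Real.pi * Complex.I * (z - a)) := by
    rw [← Complex.exp_add, ← Complex.exp_add]; congr 1; ring
  rw [thetaPair_swap hτ, thetaPair_swap hτ a, thetaPair, thetaPair, add_right_comm,
    add_sub_right_comm, theta_add_tau hτ, theta_add_tau hτ, e]
  ring

/-- Weierstrass' three-term identity. -/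
theorem thetaPair_three_term (hτ : 0 < τ.im) (a b c d : ℂ) :
    thetaPair τ a b * thetaPair τ c d - thetaPair τ a c * thetaPair τ b d +
      thetaPair τ a d * thetaPair τ b c = 0 := by
  let pt : Fin 3 → ℂ := ![a, b, c]
  -- A theta function of degree two is determined by its Fourier coefficients 0 and 1, so three of
  -- them give three vectors in ℂ² and hence a linear relation.
  let v : Fin 3 → Fin 2 → ℂ := fun i =>
    ![realFourierCoeff (thetaPair τ (pt i)) 0, realFourierCoeff (thetaPair τ (pt i)) 1]
  have hv : ¬LinearIndependent ℂ v := fun h => by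
    have := h.fintype_card_le_finrank
    simp at this
  obtain ⟨g, hg, i, hi⟩ := Fintype.not_linearIndependent_iff.1 hv
  have hcoef : ∀ n : ℤ, realFourierCoeff (fun z => ∑ i, g i * thetaPair τ (pt i) z) n =
      ∑ i, g i * realFourierCoeff (thetaPair τ (pt i)) n := by
    intro n
    unfold realFourierCoeff
    simp_rw [Finset.sum_mul]
    rw [intervalIntegral.integral_finsetSum]
    · simp_rw [mul_assoc, intervalIntegral.integral_const_mul]
    · intro i _
      refine Continuous.intervalIntegrable ?_ _ _
      have := (differentiable_thetaPair hτ (pt i)).continuous.comp Complex.continuous_ofReal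
      have h2 : Continuous fun x : ℝ => thetaPair τ (pt i) x := this
      fun_prop
  have hz : (fun z => ∑ i, g i * thetaPair τ (pt i) z) = 0 := by
    refine eq_zero_of_quasiperiodic (τ := τ) (c := Complex.exp (-(2 * Real.pi * Complex.I * τ)))
      ?_ ?_ (Complex.exp_ne_zero _) ?_ ?_ ?_
    · exact Differentiable.fun_sum fun i _ =>
        (differentiable_const _).mul (differentiable_thetaPair hτ _)
    · intro z
      simp only [thetaPair_add_one hτ]
    · intro z
      simp only [thetaPair_add_tau hτ, Finset.mul_sum]
      exact Finset.sum_congr rfl fun _ _ => by ring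
    · rw [hcoef]
      simpa [v] using congrFun hg 0
    · rw [hcoef]
      simpa [v] using congrFun hg 1
  have hz' : ∀ z, g 0 * thetaPair τ a z + g 1 * thetaPair τ b z + g 2 * thetaPair τ c z = 0 :=
    fun z => by simpa [Fin.sum_univ_three, pt] using congrFun hz z
  have hself : ∀ x, thetaPair τ x x = 0 := fun x => by
    have := thetaPair_swap hτ x x
    linear_combination this / 2
  have za := hz' a
  have zb := hz' b
  have zc := hz' c
  have zd := hz' d
  rw [hself, thetaPair_swap hτ b a, thetaPair_swap hτ c a] at za
  rw [hself, thetaPair_swap hτ c b] at zb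
  rw [hself] at zc
  -- The claim is the vanishing of the Pfaffian of the antisymmetric 4 × 4 matrix with entries
  -- `thetaPair` at a, b, c, d. The relation evaluated at these four points kills g i times the
  -- Pfaffian, for each i.
  refine (mul_eq_zero.1 ?_).resolve_left hi
  fin_cases i <;> simp only [Fin.zero_eta, Fin.mk_one, Fin.reduceFinMk]
  · linear_combination thetaPair τ c d * zb - thetaPair τ b d * zc + thetaPair τ b c * zd
  · linear_combination -thetaPair τ c d * za + thetaPair τ a d * zc - thetaPair τ a c * zd
  · linear_combination thetaPair τ b d * za - thetaPair τ a d * zb + thetaPair τ a b * zd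

end ThetaPair

/-! ### Identities for `δ` and the braid relations -/

section Delta

variable {τ : ℂ}

/-- Fay's trisecant identity. It compares the coefficients of the once-reflected translates of f in
the braid relation. -/
theorem delta_three_term (hτ : 0 < τ.im) {x y a b : ℂ} (hx : theta τ x ≠ 0) (hy : theta τ y ≠ 0)
    (hxy : theta τ (x + y) ≠ 0) (ha : theta τ a ≠ 0) (hb : theta τ b ≠ 0)
    (hab : theta τ (a + b) ≠ 0) :
    delta τ x b * delta τ y (a + b) + delta τ (x + y) (a + b) * delta τ (-x) a =
      delta τ y a * delta τ (x + y) b := by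
  -- The four points are chosen so that their sums and differences are, up to sign, the theta
  -- arguments left after clearing denominators.
  have h := thetaPair_three_term hτ ((x + a + b) / 2 + y) ((x + b - a) / 2) ((x + a + b) / 2)
    ((x - a - b) / 2)
  unfold thetaPair at h
  rw [show (x + a + b) / 2 + y + (x + b - a) / 2 = x + y + b by ring,
    show (x + a + b) / 2 + y - (x + b - a) / 2 = y + a by ring,
    show (x + a + b) / 2 + (x - a - b) / 2 = x by ring,
    show (x + a + b) / 2 - (x - a - b) / 2 = a + b by ring,
    show (x + a + b) / 2 + y + (x + a + b) / 2 = x + y + (a + b) by ring,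
    show (x + a + b) / 2 + y - (x + a + b) / 2 = y by ring,
    show (x + b - a) / 2 + (x - a - b) / 2 = -(-x + a) by ring,
    show (x + b - a) / 2 - (x - a - b) / 2 = b by ring,
    show (x + a + b) / 2 + y + (x - a - b) / 2 = x + y by ring,
    show (x + a + b) / 2 + y - (x - a - b) / 2 = y + (a + b) by ring,
    show (x + b - a) / 2 + (x + a + b) / 2 = x + b by ring,
    show (x + b - a) / 2 - (x + a + b) / 2 = -a by ring, theta_neg hτ, theta_neg hτ a] at h
  unfold delta
  rw [theta_neg hτ x]
  field_simp
  linear_combination -deriv (theta τ) 0 ^ 2 * h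

/-- In terms of the Weierstrass function, δ(x, h)δ(-x, h) = ℘(h) - ℘(x), so h drops out of the
difference. It is the three-term identity with fourth point 0. -/
theorem delta_mul_delta_neg_sub (hτ : 0 < τ.im) {x y h : ℂ} (hx : theta τ x ≠ 0)
    (hy : theta τ y ≠ 0) (hh : theta τ h ≠ 0) :
    delta τ x h * delta τ (-x) h - delta τ y h * delta τ (-y) h =
      deriv (theta τ) 0 ^ 2 * theta τ (x + y) * theta τ (x - y) /
        (theta τ x ^ 2 * theta τ y ^ 2) := by
  have key := thetaPair_three_term hτ x h y 0
  rw [thetaPair_swap hτ h y] at key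
  simp only [thetaPair, add_zero, sub_zero] at key
  unfold delta
  rw [show -x + h = -(x - h) by ring, show -y + h = -(y - h) by ring, theta_neg hτ, theta_neg hτ,
    theta_neg hτ, theta_neg hτ]
  field_simp
  linear_combination deriv (theta τ) 0 ^ 2 * key

/-- Another instance of the three-term identity, at points whose sums and differences are the
required arguments. The right side depends on a and b only through a + b, which lets it match
`delta_mul_delta_neg_sub`. -/
theorem delta_triple_sub (hτ : 0 < τ.im) {x y a b : ℂ} (hx : theta τ x ≠ 0)
    (hy : theta τ y ≠ 0) (ha : theta τ a ≠ 0) (hb : theta τ b ≠ 0)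
    (hab : theta τ (a + b) ≠ 0) :
    delta τ x a * delta τ x b * delta τ y (a + b) - delta τ y a * delta τ y b * delta τ x (a + b) =
      -(deriv (theta τ) 0 ^ 3 * theta τ (x + y + (a + b)) * theta τ (x - y)) /
        (theta τ x ^ 2 * theta τ y ^ 2 * theta τ (a + b)) := by
  have key := thetaPair_three_term hτ (y + (a + b) / 2) ((a + b) / 2) (x + (a + b) / 2)
    ((a - b) / 2)
  unfold thetaPair at key
  rw [show y + (a + b) / 2 + (a + b) / 2 = y + (a + b) by ring,
    show y + (a + b) / 2 - (a + b) / 2 = y by ring,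
    show x + (a + b) / 2 + (a - b) / 2 = x + a by ring,
    show x + (a + b) / 2 - (a - b) / 2 = x + b by ring,
    show y + (a + b) / 2 + (x + (a + b) / 2) = x + y + (a + b) by ring,
    show y + (a + b) / 2 - (x + (a + b) / 2) = -(x - y) by ring,
    show (a + b) / 2 + (a - b) / 2 = a by ring,
    show (a + b) / 2 - (a - b) / 2 = b by ring,
    show y + (a + b) / 2 + (a - b) / 2 = y + a by ring,
    show y + (a + b) / 2 - (a - b) / 2 = y + b by ring,
    show (a + b) / 2 + (x + (a + b) / 2) = x + (a + b) by ring,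
    show (a + b) / 2 - (x + (a + b) / 2) = -x by ring, theta_neg hτ, theta_neg hτ x] at key
  unfold delta
  field_simp
  linear_combination deriv (theta τ) 0 ^ 3 * key

/-- The two preceding differences cancel once the second-degree one is multiplied by δ(x + y, a +
b), whose denominator removes θ(x + y). This is the coefficient of f itself in the braid relation.
-/
theorem delta_braid (hτ : 0 < τ.im) {x y a b h : ℂ} (hx : theta τ x ≠ 0)
    (hy : theta τ y ≠ 0) (hxy : theta τ (x + y) ≠ 0) (ha : theta τ a ≠ 0) (hb : theta τ b ≠ 0)
    (hab : theta τ (a + b) ≠ 0) (hh : theta τ h ≠ 0) :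
    delta τ x a * delta τ x b * delta τ y (a + b) +
        delta τ (x + y) (a + b) * (delta τ x h * delta τ (-x) h) =
      delta τ y a * delta τ y b * delta τ x (a + b) +
        delta τ (x + y) (a + b) * (delta τ y h * delta τ (-y) h) := by
  have h1 := delta_mul_delta_neg_sub hτ hx hy hh
  have h2 := delta_triple_sub hτ hx hy ha hb hab
  have h3 : delta τ (x + y) (a + b) * (deriv (theta τ) 0 ^ 2 * theta τ (x + y) * theta τ (x - y) /
        (theta τ x ^ 2 * theta τ y ^ 2)) = deriv (theta τ) 0 ^ 3 * theta τ (x + y + (a + b)) *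
        theta τ (x - y) / (theta τ x ^ 2 * theta τ y ^ 2 * theta τ (a + b)) := by
    unfold delta
    field_simp
  rw [neg_div] at h2
  linear_combination h2 + delta τ (x + y) (a + b) * h1 + h3

end Delta

/-! ### Elliptic Demazure operations on functions -/

theorem permVar_mul (v w : Equiv.Perm (Fin m)) :
    (permVar (v * w) : Var m r → Var m r) = permVar v ∘ permVar w := by
  funext t
  cases t <;> rfl

theorem Character.IsParameter.value_comp {ν : Character m r} (hν : ν.IsParameter)
    (w : Equiv.Perm (Fin m)) (p : Var m r → ℂ) : ν.value (p ∘ permVar w) = ν.value p := by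
  refine Finset.sum_congr rfl fun v _ => ?_
  cases v with
  | x i => simp [hν.1 i]
  | u => rfl
  | h => rfl
  | mu j => rfl

theorem lowIdx_ne_highIdx (i : Fin (m - 1)) : lowIdx i ≠ highIdx i := by
  simp [lowIdx, highIdx]

theorem lowIdx_eq_highIdx {i j : Fin (m - 1)} (hij : j.1 = i.1 + 1) : lowIdx j = highIdx i := by
  simp [lowIdx, highIdx, hij]

theorem lowIdx_ne_highIdx_succ {i j : Fin (m - 1)} (hij : j.1 = i.1 + 1) :
    lowIdx i ≠ highIdx j := by
  simp [lowIdx, highIdx]; omega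

theorem simpleRefl_of_far {i j : Fin (m - 1)} (hij : i.1 + 1 < j.1) :
    simpleRefl i (lowIdx j) = lowIdx j ∧ simpleRefl i (highIdx j) = highIdx j ∧
      simpleRefl j (lowIdx i) = lowIdx i ∧ simpleRefl j (highIdx i) = highIdx i := by
  have h1 : lowIdx i ≠ lowIdx j := by simp [lowIdx]; omega
  have h2 : lowIdx i ≠ highIdx j := by simp [lowIdx, highIdx]; omega
  have h3 : highIdx i ≠ lowIdx j := by simp [lowIdx, highIdx]; omega
  have h4 : highIdx i ≠ highIdx j := by simp [highIdx]; omega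
  exact ⟨Equiv.swap_apply_of_ne_of_ne h1.symm h3.symm, Equiv.swap_apply_of_ne_of_ne h2.symm h4.symm,
    Equiv.swap_apply_of_ne_of_ne h1 h2, Equiv.swap_apply_of_ne_of_ne h3 h4⟩

theorem simpleRefl_mul_comm {i j : Fin (m - 1)} (hij : i.1 + 1 < j.1) :
    simpleRefl i * simpleRefl j = simpleRefl j * simpleRefl i := by
  refine Equiv.Perm.Disjoint.commute fun t => ?_
  obtain ⟨-, -, h1, h2⟩ := simpleRefl_of_far hij
  by_cases ht : t = lowIdx i ∨ t = highIdx i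
  · right
    rcases ht with rfl | rfl
    exacts [h1, h2]
  · left
    push Not at ht
    exact Equiv.swap_apply_of_ne_of_ne ht.1 ht.2

theorem simpleRefl_braid {i j : Fin (m - 1)} (hij : j.1 = i.1 + 1) :
    simpleRefl i * simpleRefl j * simpleRefl i = simpleRefl j * simpleRefl i * simpleRefl j := by
  have e := lowIdx_eq_highIdx hij
  have n1 := lowIdx_ne_highIdx i
  have n2 := e ▸ lowIdx_ne_highIdx j
  have n3 := lowIdx_ne_highIdx_succ hij
  have h1 := Equiv.swap_mul_swap_mul_swap (x := highIdx j) (y := highIdx i) (z := lowIdx i)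
    n2.symm n3.symm
  have h2 := Equiv.swap_mul_swap_mul_swap (x := lowIdx i) (y := highIdx i) (z := highIdx j)
    n1 n3
  unfold simpleRefl
  rw [e, Equiv.swap_comm (lowIdx i) (highIdx i), Equiv.swap_comm (highIdx i) (highIdx j), h1,
    Equiv.swap_comm (highIdx j) (highIdx i), Equiv.swap_comm (highIdx i) (lowIdx i), h2,
    Equiv.swap_comm]

/-- The δ-factors of each operation are invariant under the other reflection, so equality holds at
every point, with no genericity condition. -/
theorem demazure_comm (τ : ℂ) {i j : Fin (m - 1)} (hij : i.1 + 1 < j.1) {ν χ : Character m r}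
    (hν : ν.IsParameter) (hχ : χ.IsParameter) (f : (Var m r → ℂ) → ℂ) :
    demazure τ i ν (demazure τ j χ f) = demazure τ j χ (demazure τ i ν f) := by
  obtain ⟨h1, h2, h3, h4⟩ := simpleRefl_of_far hij
  have hs := simpleRefl_mul_comm hij
  funext p
  simp only [demazure, hν.value_comp, hχ.value_comp, Function.comp_apply, permVar]
  simp only [h1, h2, h3, h4]
  change _ + _ * (_ + _ * f (p ∘ permVar (simpleRefl i) ∘ permVar (simpleRefl j))) =
    _ + _ * (_ + _ * f (p ∘ permVar (simpleRefl j) ∘ permVar (simpleRefl i)))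
  rw [← permVar_mul, ← permVar_mul, hs]
  ring

/-- The braid relation with f₁, …, f₆ standing for the values of f at the six translates. The
coefficients of f₄, f₅, f₆ agree literally, those of f₂ and f₃ by Fay's identity, that of f₁ by
`delta_braid`. -/
theorem delta_braid_combination {τ : ℂ} (hτ : 0 < τ.im) {x₁ x₂ x₃ a b h : ℂ}
    (hx : theta τ (x₂ - x₁) ≠ 0) (hy : theta τ (x₃ - x₂) ≠ 0) (hxy : theta τ (x₃ - x₁) ≠ 0)
    (ha : theta τ a ≠ 0) (hb : theta τ b ≠ 0) (hab : theta τ (a + b) ≠ 0) (hh : theta τ h ≠ 0)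
    (f₁ f₂ f₃ f₄ f₅ f₆ : ℂ) :
    delta τ (x₂ - x₁) b *
        (delta τ (x₃ - x₂) (a + b) * (delta τ (x₂ - x₁) a * f₁ + delta τ (x₁ - x₂) h * f₂) +
          delta τ (x₂ - x₃) h * (delta τ (x₃ - x₁) a * f₃ + delta τ (x₁ - x₃) h * f₄)) +
      delta τ (x₁ - x₂) h *
        (delta τ (x₃ - x₁) (a + b) * (delta τ (x₁ - x₂) a * f₂ + delta τ (x₂ - x₁) h * f₁) +
          delta τ (x₁ - x₃) h * (delta τ (x₃ - x₂) a * f₅ + delta τ (x₂ - x₃) h * f₆)) =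
    delta τ (x₃ - x₂) a *
        (delta τ (x₂ - x₁) (a + b) * (delta τ (x₃ - x₂) b * f₁ + delta τ (x₂ - x₃) h * f₃) +
          delta τ (x₁ - x₂) h * (delta τ (x₃ - x₁) b * f₂ + delta τ (x₁ - x₃) h * f₅)) +
      delta τ (x₂ - x₃) h *
        (delta τ (x₃ - x₁) (a + b) * (delta τ (x₂ - x₃) b * f₃ + delta τ (x₃ - x₂) h * f₁) +
          delta τ (x₁ - x₃) h * (delta τ (x₂ - x₁) b * f₄ + delta τ (x₁ - x₂) h * f₆)) := by
  obtain ⟨x, rfl⟩ : ∃ x, x₂ = x₁ + x := ⟨x₂ - x₁, by ring⟩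
  obtain ⟨y, rfl⟩ : ∃ y, x₃ = x₁ + x + y := ⟨x₃ - (x₁ + x), by ring⟩
  rw [show x₁ + x - x₁ = x by ring] at hx
  rw [show x₁ + x + y - (x₁ + x) = y by ring] at hy
  rw [show x₁ + x + y - x₁ = x + y by ring] at hxy
  have k1 := delta_three_term hτ hx hy hxy ha hb hab
  have k2 := delta_three_term hτ hy hx (by rwa [add_comm]) hb ha (by rwa [add_comm])
  have k3 := delta_braid hτ hx hy hxy ha hb hab hh
  rw [add_comm y x, add_comm b a] at k2
  rw [show x₁ + x - x₁ = x by ring, show x₁ + x + y - (x₁ + x) = y by ring,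
    show x₁ + x + y - x₁ = x + y by ring, show x₁ - (x₁ + x) = -x by ring,
    show x₁ + x - (x₁ + x + y) = -y by ring]
  linear_combination f₁ * k3 + delta τ (-x) h * f₂ * k1 - delta τ (-y) h * f₃ * k2

theorem comp_permVar_simpleRefl_twice (i : Fin (m - 1)) (p : Var m r → ℂ) :
    (p ∘ permVar (simpleRefl i)) ∘ permVar (simpleRefl i) = p := by
  rw [Function.comp_assoc, ← permVar_mul, simpleRefl, Equiv.swap_mul_self]
  funext v
  cases v <;> rfl

theorem demazure_braid {τ : ℂ} (hτ : 0 < τ.im) {i j : Fin (m - 1)} (hij : j.1 = i.1 + 1)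
    {a b : Character m r} (ha : a.IsParameter) (hb : b.IsParameter) (f : (Var m r → ℂ) → ℂ)
    (p : Var m r → ℂ)
    (hx : theta τ (p (Var.x (highIdx i)) - p (Var.x (lowIdx i))) ≠ 0)
    (hy : theta τ (p (Var.x (highIdx j)) - p (Var.x (lowIdx j))) ≠ 0)
    (hxy : theta τ (p (Var.x (highIdx j)) - p (Var.x (lowIdx i))) ≠ 0)
    (hav : theta τ (a.value p) ≠ 0) (hbv : theta τ (b.value p) ≠ 0)
    (habv : theta τ ((a + b : Character m r).value p) ≠ 0) (hh : theta τ (p Var.h) ≠ 0) :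
    demazure τ i b (demazure τ j (a + b) (demazure τ i a f)) p =
      demazure τ j a (demazure τ i (a + b) (demazure τ j b f)) p := by
  have hab : (a + b : Character m r).IsParameter :=
    ⟨fun k => by simp [ha.1, hb.1], by simp [ha.2, hb.2]⟩
  have e := lowIdx_eq_highIdx hij
  have n1 := lowIdx_ne_highIdx i
  have n2 := e ▸ lowIdx_ne_highIdx j
  have n3 := lowIdx_ne_highIdx_succ hij
  have hs := simpleRefl_braid hij
  -- Both words of the longest element lead to the same sixth translate.
  have hs' : ((p ∘ permVar (simpleRefl i)) ∘ permVar (simpleRefl j)) ∘ permVar (simpleRefl i) =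
      ((p ∘ permVar (simpleRefl j)) ∘ permVar (simpleRefl i)) ∘ permVar (simpleRefl j) := by
    simp only [Function.comp_assoc, ← permVar_mul]
    rw [hs]
  simp only [demazure, hab.value_comp, ha.value_comp, hb.value_comp, hs',
    comp_permVar_simpleRefl_twice]
  simp only [Function.comp_apply, permVar, e] at hy ⊢
  simp only [simpleRefl, e, Equiv.swap_apply_left, Equiv.swap_apply_right,
    Equiv.swap_apply_of_ne_of_ne n1 n3, Equiv.swap_apply_of_ne_of_ne n3.symm n2.symm]
  rw [value_add] at habv ⊢
  exact delta_braid_combination hτ hx hy hxy hav hbv habv hh _ _ _ _ _ _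

/-! ### Dense open sets and equality of meromorphic functions -/

theorem Character.differentiable_value (L : Character m r) : Differentiable ℂ L.value := by
  unfold Character.value
  fun_prop

/-- A nonzero linear form is surjective, hence open; preimages of dense sets under it are therefore
dense. -/
theorem Character.isOpenMap_value {L : Character m r} (hL : L ≠ 0) : IsOpenMap L.value := by
  obtain ⟨v, hv⟩ := Function.ne_iff.1 hL
  have hv' : (L v : ℂ) ≠ 0 := by simpa using hv
  let F : (Var m r → ℂ) →ₗ[ℂ] ℂ := ∑ v, (L v : ℂ) • LinearMap.proj v
  have hF : ∀ p, F p = L.value p := fun p => by simp [F, Character.value]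
  have hsurj : Function.Surjective F := fun z =>
    ⟨Pi.single v (z / L v), by
      rw [hF]
      simp [Character.value, Pi.single_apply, mul_div_cancel₀ _ hv']⟩
  have := F.isOpenMap_of_finiteDimensional hsurj
  rwa [show (F : (Var m r → ℂ) → ℂ) = L.value from funext hF] at this

theorem isOpen_theta_value_ne_zero {τ : ℂ} (hτ : 0 < τ.im) (L : Character m r) :
    IsOpen {p | theta τ (L.value p) ≠ 0} :=
  isOpen_ne.preimage ((differentiable_theta hτ).comp L.differentiable_value).continuous

theorem dense_theta_value_ne_zero {τ : ℂ} (hτ : 0 < τ.im) {L : Character m r} (hL : L ≠ 0) :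
    Dense {p | theta τ (L.value p) ≠ 0} :=
  (dense_theta_ne_zero hτ).preimage (Character.isOpenMap_value hL)

theorem isOpen_dense_forall_theta_ne_zero {τ : ℂ} (hτ : 0 < τ.im) (Ls : List (Character m r))
    (h : ∀ L ∈ Ls, L ≠ 0) :
    IsOpen {p | ∀ L ∈ Ls, theta τ (L.value p) ≠ 0} ∧
      Dense {p | ∀ L ∈ Ls, theta τ (L.value p) ≠ 0} := by
  induction Ls with
  | nil => simp
  | cons L Ls ih =>
    obtain ⟨h1, h2⟩ := ih fun L' hL' => h L' (List.mem_cons_of_mem _ hL')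
    have e : {p | ∀ K ∈ L :: Ls, theta τ (K.value p) ≠ 0} =
        {p | theta τ (L.value p) ≠ 0} ∩ {p | ∀ K ∈ Ls, theta τ (K.value p) ≠ 0} := by
      ext p
      simp
    rw [e]
    exact ⟨(isOpen_theta_value_ne_zero hτ L).inter h1,
      (dense_theta_value_ne_zero hτ (h L List.mem_cons_self)).inter_of_isOpen_right h2 h1⟩

theorem MeroEq.refl (f : (Var m r → ℂ) → ℂ) : MeroEq f f :=
  ⟨Set.univ, isOpen_univ, dense_univ, fun _ _ => rfl⟩

theorem MeroEq.symm {f g : (Var m r → ℂ) → ℂ} (h : MeroEq f g) : MeroEq g f := by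
  obtain ⟨U, h1, h2, h3⟩ := h
  exact ⟨U, h1, h2, h3.symm⟩

theorem MeroEq.trans {f g k : (Var m r → ℂ) → ℂ} (h : MeroEq f g) (h' : MeroEq g k) :
    MeroEq f k := by
  obtain ⟨U, h1, h2, h3⟩ := h
  obtain ⟨V, k1, k2, k3⟩ := h'
  exact ⟨U ∩ V, h1.inter k1, h2.inter_of_isOpen_right k2 k1,
    fun p hp => (h3 hp.1).trans (k3 hp.2)⟩

/-- The operation evaluates at p and at s_i p, so equality survives on U ∩ s_i U, which is again
open and dense. -/
theorem MeroEq.demazure {f g : (Var m r → ℂ) → ℂ} (h : MeroEq f g) (τ : ℂ) (i : Fin (m - 1))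
    (ν : Character m r) : MeroEq (demazure τ i ν f) (demazure τ i ν g) := by
  obtain ⟨U, h1, h2, h3⟩ := h
  have hinv : ∀ p : Var m r → ℂ, (p ∘ permVar (simpleRefl i)) ∘ permVar (simpleRefl i) = p :=
    comp_permVar_simpleRefl_twice i
  have hcont : Continuous fun p : Var m r → ℂ => p ∘ permVar (simpleRefl i) := by
    unfold Function.comp
    fun_prop
  let σ : (Var m r → ℂ) ≃ₜ (Var m r → ℂ) :=
    { toFun := fun p => p ∘ permVar (simpleRefl i)
      invFun := fun p => p ∘ permVar (simpleRefl i)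
      left_inv := hinv
      right_inv := hinv
      continuous_toFun := hcont
      continuous_invFun := hcont }
  refine ⟨U ∩ σ ⁻¹' U, h1.inter (h1.preimage σ.continuous),
    h2.inter_of_isOpen_right (h2.preimage σ.isOpenMap) (h1.preimage σ.continuous), ?_⟩
  intro p hp
  have e1 : f p = g p := h3 hp.1
  have e2 : f (p ∘ permVar (simpleRefl i)) = g (p ∘ permVar (simpleRefl i)) := h3 hp.2
  simp only [LinkPattern.demazure, e1, e2]

theorem coord_x_sub_coord_x_ne_zero {i j : Fin m} (h : i ≠ j) :
    (coord (Var.x i) - coord (Var.x j) : Character m r) ≠ 0 := by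
  intro h0
  have := congrFun h0 (Var.x i)
  simp [coord, h] at this

theorem coord_ne_zero (v : Var m r) : coord v ≠ 0 := by
  intro h0
  have := congrFun h0 v
  simp [coord] at this

/-- Nontriviality of a, b and a + b makes the exceptional set the zero locus of finitely many θ(L)
with L ≠ 0, whose complement is dense. -/
theorem meroEq_demazure_braid {τ : ℂ} (hτ : 0 < τ.im) {i j : Fin (m - 1)} (hij : j.1 = i.1 + 1)
    {a b : Character m r} (ha : a.IsParameter) (hb : b.IsParameter) (ha0 : a ≠ 0) (hb0 : b ≠ 0)
    (hab0 : a + b ≠ 0) (f : (Var m r → ℂ) → ℂ) :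
    MeroEq (demazure τ i b (demazure τ j (a + b) (demazure τ i a f)))
      (demazure τ j a (demazure τ i (a + b) (demazure τ j b f))) := by
  let Ls : List (Character m r) := [coord (Var.x (highIdx i)) - coord (Var.x (lowIdx i)),
    coord (Var.x (highIdx j)) - coord (Var.x (lowIdx j)),
    coord (Var.x (highIdx j)) - coord (Var.x (lowIdx i)), a, b, a + b, coord Var.h]
  have n3 : highIdx j ≠ lowIdx i := by simp [lowIdx, highIdx]; omega
  obtain ⟨h1, h2⟩ := isOpen_dense_forall_theta_ne_zero hτ Ls (by
    simp [Ls, ha0, hb0, hab0, coord_ne_zero,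
      coord_x_sub_coord_x_ne_zero (lowIdx_ne_highIdx i).symm,
      coord_x_sub_coord_x_ne_zero (lowIdx_ne_highIdx j).symm, coord_x_sub_coord_x_ne_zero n3])
  refine ⟨_, h1, h2, fun p hp => ?_⟩
  simp only [Ls, Set.mem_ofPred_eq, List.forall_mem_cons, value_sub, value_coord] at hp
  obtain ⟨hx, hy, hxy, hav, hbv, habv, hh, -⟩ := hp
  exact demazure_braid hτ hij ha hb f p hx hy hxy hav hbv habv hh

/-! ### Meromorphy -/

namespace ThetaExpr

/-- No function `θ(0)⁻¹` occurs in the combination. -/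
def IsNonsingular : ThetaExpr m r → Prop
  | const _ => True
  | theta _ => True
  | thetaInv L => L ≠ 0
  | mul a b => IsNonsingular a ∧ IsNonsingular b
  | add a b => IsNonsingular a ∧ IsNonsingular b

/-- Denominators are products of functions θ(L) with L ≠ 0, so one global quotient serves at all
points. -/
theorem IsNonsingular.exists_div_eq {τ : ℂ} (hτ : 0 < τ.im) {e : ThetaExpr m r}
    (he : e.IsNonsingular) :
    ∃ a b : (Var m r → ℂ) → ℂ, (∀ p, AnalyticAt ℂ a p) ∧ (∀ p, AnalyticAt ℂ b p) ∧
      Dense {p | b p ≠ 0} ∧ ∀ p, b p ≠ 0 → e.eval τ p = a p / b p := by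
  have hθ : ∀ (L : Character m r) p, AnalyticAt ℂ (fun z => LinkPattern.theta τ (L.value z)) p := by
    intro L p
    have h1 : AnalyticAt ℂ (LinkPattern.theta τ) (L.value p) := (differentiable_theta hτ).analyticAt _
    have h2 : AnalyticAt ℂ L.value p := by
      unfold Character.value
      exact Finset.analyticAt_fun_sum _ fun v _ => analyticAt_const.mul
        ((ContinuousLinearMap.proj (R := ℂ) (φ := fun _ : Var m r => ℂ) v).analyticAt p)
    exact h1.comp h2
  have hd : ∀ b₁ b₂ : (Var m r → ℂ) → ℂ, (∀ p, AnalyticAt ℂ b₁ p) → (∀ p, AnalyticAt ℂ b₂ p) →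
      Dense {p | b₁ p ≠ 0} → Dense {p | b₂ p ≠ 0} → Dense {p | b₁ p * b₂ p ≠ 0} := by
    intro b₁ b₂ h1 h2 d1 d2
    have hc : Continuous b₂ := continuous_iff_continuousAt.2 fun p => (h2 p).continuousAt
    have := d1.inter_of_isOpen_right d2 (isOpen_ne.preimage hc)
    refine this.mono fun p hp => mul_ne_zero hp.1 hp.2
  induction e with
  | const c => exact ⟨fun _ => c, fun _ => 1, fun _ => analyticAt_const, fun _ => analyticAt_const,
      by simp, fun p _ => by simp [eval]⟩
  | theta L => exact ⟨_, fun _ => 1, hθ L, fun _ => analyticAt_const, by simp,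
      fun p _ => by simp [eval]⟩
  | thetaInv L => exact ⟨fun _ => 1, _, fun _ => analyticAt_const, hθ L,
      dense_theta_value_ne_zero hτ he, fun p _ => by simp [eval]⟩
  | mul e₁ e₂ ih₁ ih₂ =>
    obtain ⟨a₁, b₁, ha₁, hb₁, d₁, h₁⟩ := ih₁ he.1
    obtain ⟨a₂, b₂, ha₂, hb₂, d₂, h₂⟩ := ih₂ he.2
    refine ⟨fun p => a₁ p * a₂ p, fun p => b₁ p * b₂ p, fun p => (ha₁ p).mul (ha₂ p),
      fun p => (hb₁ p).mul (hb₂ p), hd _ _ hb₁ hb₂ d₁ d₂, fun p hp => ?_⟩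
    rw [eval, h₁ p (left_ne_zero_of_mul hp), h₂ p (right_ne_zero_of_mul hp), div_mul_div_comm]
  | add e₁ e₂ ih₁ ih₂ =>
    obtain ⟨a₁, b₁, ha₁, hb₁, d₁, h₁⟩ := ih₁ he.1
    obtain ⟨a₂, b₂, ha₂, hb₂, d₂, h₂⟩ := ih₂ he.2
    refine ⟨fun p => a₁ p * b₂ p + b₁ p * a₂ p, fun p => b₁ p * b₂ p,
      fun p => ((ha₁ p).mul (hb₂ p)).add ((hb₁ p).mul (ha₂ p)),
      fun p => (hb₁ p).mul (hb₂ p), hd _ _ hb₁ hb₂ d₁ d₂, fun p hp => ?_⟩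
    rw [eval, h₁ p (left_ne_zero_of_mul hp), h₂ p (right_ne_zero_of_mul hp),
      div_add_div _ _ (left_ne_zero_of_mul hp) (right_ne_zero_of_mul hp)]

theorem IsNonsingular.isMeromorphic {τ : ℂ} (hτ : 0 < τ.im) {e : ThetaExpr m r}
    (he : e.IsNonsingular) : IsMeromorphic (e.eval τ) := by
  obtain ⟨a, b, ha, hb, hd, h⟩ := he.exists_div_eq hτ
  exact fun p => ⟨a, b, ha p, hb p, mem_closure_iff_frequently.1 (hd p), .of_forall h⟩

theorem IsNonsingular.perm {e : ThetaExpr m r} (he : e.IsNonsingular) (w : Equiv.Perm (Fin m)) :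
    (e.perm w).IsNonsingular := by
  induction e with
  | const c => trivial
  | theta L => trivial
  | thetaInv L =>
    intro h0
    refine he (funext fun v => ?_)
    simpa [permVar_inv_apply] using congrFun h0 (permVar w v)
  | mul a b iha ihb => exact ⟨iha he.1, ihb he.2⟩
  | add a b iha ihb => exact ⟨iha he.1, ihb he.2⟩

theorem isNonsingular_delta (τ : ℂ) {K L : Character m r} (hK : K ≠ 0) (hL : L ≠ 0) :
    (delta τ K L).IsNonsingular :=
  ⟨trivial, trivial, hK, hL⟩

theorem IsNonsingular.demazure {e : ThetaExpr m r} (he : e.IsNonsingular) (τ : ℂ)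
    (i : Fin (m - 1)) {ν : Character m r} (hν : ν ≠ 0) : (e.demazure τ i ν).IsNonsingular :=
  ⟨⟨isNonsingular_delta τ (coord_x_sub_coord_x_ne_zero (lowIdx_ne_highIdx i).symm) hν, he⟩,
    isNonsingular_delta τ (coord_x_sub_coord_x_ne_zero (lowIdx_ne_highIdx i)) (coord_ne_zero _),
    he.perm _⟩

theorem isNonsingular_listProd {es : List (ThetaExpr m r)} (h : ∀ e ∈ es, e.IsNonsingular) :
    (listProd es).IsNonsingular := by
  induction es with
  | nil => trivial
  | cons e es ih =>
    exact ⟨h e List.mem_cons_self, ih fun e' he' => h e' (List.mem_cons_of_mem _ he')⟩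

end ThetaExpr

theorem isNonsingular_ellMin (τ : ℂ) (hmr : 2 * r ≤ m) : (ellMin τ hmr).IsNonsingular := by
  -- The variable u keeps the first arguments of δ nonzero, whatever the two positions are.
  have hu : ∀ i j : Fin m,
      (coord Var.u + coord (Var.x i) - coord (Var.x j) : Character m r) ≠ 0 := by
    intro i j h0
    have := congrFun h0 Var.u
    simp [coord] at this
  refine ThetaExpr.isNonsingular_listProd ?_
  simp only [List.mem_map, forall_exists_index, and_imp, forall_apply_eq_imp_iff₂]
  intro i _
  refine ⟨ThetaExpr.isNonsingular_delta τ (hu _ _) (coord_ne_zero _),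
    ThetaExpr.isNonsingular_listProd ?_⟩
  simp only [List.mem_map, forall_exists_index, and_imp, forall_apply_eq_imp_iff₂]
  intro j _
  exact ThetaExpr.isNonsingular_delta τ (hu _ _) (coord_ne_zero _)

/-! ### Types -/

theorem toPoly_add (K L : Character m r) :
    (K + L : Character m r).toPoly = K.toPoly + L.toPoly := by
  simp [Character.toPoly, add_mul, Finset.sum_add_distrib]

theorem toPoly_sub (K L : Character m r) :
    (K - L : Character m r).toPoly = K.toPoly - L.toPoly := by
  simp [Character.toPoly, sub_mul, Finset.sum_sub_distrib]

theorem toPoly_coord (v : Var m r) : (coord v).toPoly = MvPolynomial.X v := by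
  simp [Character.toPoly, coord, Pi.single_apply]

theorem eval_single_toPoly (L : Character m r) (v : Var m r) :
    MvPolynomial.eval (Pi.single v 1) L.toPoly = L v := by
  simp [Character.toPoly, Pi.single_apply]

theorem toPoly_injective : Function.Injective (Character.toPoly : Character m r → _) := by
  intro K L h
  funext v
  have := congrArg (MvPolynomial.eval (Pi.single v 1)) h
  rw [eval_single_toPoly, eval_single_toPoly] at this
  exact_mod_cast this

theorem qval_toPoly (L : Character m r) (z : Var m r → ℂ) : qval L.toPoly z = L.value z := by
  simp [qval, Character.toPoly, Character.value]

theorem toPoly_comp_permVar (w : Equiv.Perm (Fin m)) (L : Character m r) :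
    Character.toPoly (L ∘ permVar w⁻¹) = MvPolynomial.rename (permVar w) L.toPoly := by
  unfold Character.toPoly
  rw [map_sum]
  refine Finset.sum_bij' (fun v _ => permVar w⁻¹ v) (fun v _ => permVar w v) ?_ ?_ ?_ ?_ ?_
  · simp
  · simp
  · intro v _; exact permVar_apply_inv w v
  · intro v _; exact permVar_inv_apply w v
  · intro v _; simp [permVar_apply_inv]

namespace ThetaExpr

/-- The type belongs to the formal combination, not to the function, so it is unique even when the
function is zero. -/
theorem HasType.unique {e : ThetaExpr m r} {Q Q' : MvPolynomial (Var m r) ℚ} (h : e.HasType Q)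
    (h' : e.HasType Q') : Q = Q' := by
  induction e generalizing Q Q' with
  | const c => exact Eq.trans h (Eq.symm h')
  | theta L => exact Eq.trans h (Eq.symm h')
  | thetaInv L => exact Eq.trans h (Eq.symm h')
  | mul a b iha ihb =>
    obtain ⟨Q₁, Q₂, h1, h2, rfl⟩ := h
    obtain ⟨Q₁', Q₂', h1', h2', rfl⟩ := h'
    rw [iha h1 h1', ihb h2 h2']
  | add a b iha ihb => exact iha h.1 h'.1

theorem HasType.perm {e : ThetaExpr m r} {Q : MvPolynomial (Var m r) ℚ} (h : e.HasType Q)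
    (w : Equiv.Perm (Fin m)) : (e.perm w).HasType (MvPolynomial.rename (permVar w) Q) := by
  induction e generalizing Q with
  | const c =>
    obtain rfl : Q = 0 := h
    exact map_zero _
  | theta L =>
    obtain rfl := h
    simp only [ThetaExpr.perm, HasType, toPoly_comp_permVar, map_mul, map_pow, MvPolynomial.rename_C]
  | thetaInv L =>
    obtain rfl := h
    simp only [ThetaExpr.perm, HasType, toPoly_comp_permVar, map_neg, map_mul, map_pow,
      MvPolynomial.rename_C]
  | mul a b iha ihb =>
    obtain ⟨Q₁, Q₂, h1, h2, rfl⟩ := h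
    exact ⟨_, _, iha h1, ihb h2, map_add _ _ _⟩
  | add a b iha ihb => exact ⟨iha h.1, ihb h.2⟩

/-- Polarization: ½(K + L)² - ½K² - ½L² = KL. -/
theorem hasType_delta (τ : ℂ) (K L : Character m r) :
    (delta τ K L).HasType (K.toPoly * L.toPoly) := by
  refine ⟨_, _, rfl, ⟨_, _, rfl, ⟨_, _, rfl, rfl, rfl⟩, rfl⟩, ?_⟩
  rw [toPoly_add]
  have h : (MvPolynomial.C (1 / 2 : ℚ) : MvPolynomial (Var m r) ℚ) * 2 = 1 := by
    rw [show (2 : MvPolynomial (Var m r) ℚ) = MvPolynomial.C 2 from rfl, ← MvPolynomial.C_mul]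
    norm_num
  linear_combination (-(K.toPoly * L.toPoly)) * h

theorem hasType_demazure_iff (τ : ℂ) (i : Fin (m - 1)) (ν : Character m r) {e : ThetaExpr m r}
    {Q : MvPolynomial (Var m r) ℚ} (h : e.HasType Q) (Q' : MvPolynomial (Var m r) ℚ) :
    (e.demazure τ i ν).HasType Q' ↔
      Q' = (MvPolynomial.X (Var.x (highIdx i)) - MvPolynomial.X (Var.x (lowIdx i))) * ν.toPoly + Q ∧
      Q' = (MvPolynomial.X (Var.x (lowIdx i)) - MvPolynomial.X (Var.x (highIdx i))) *
        MvPolynomial.X Var.h + MvPolynomial.rename (permVar (simpleRefl i)) Q := by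
  have h1 := hasType_delta τ (coord (Var.x (highIdx i)) - coord (Var.x (lowIdx i))) ν
  have h2 := hasType_delta τ (coord (Var.x (lowIdx i)) - coord (Var.x (highIdx i)))
    (coord (Var.h : Var m r))
  rw [toPoly_sub, toPoly_coord, toPoly_coord] at h1 h2
  rw [toPoly_coord] at h2
  constructor
  · intro h'
    exact ⟨h'.1.unique ⟨_, _, h1, h, rfl⟩, h'.2.unique ⟨_, _, h2, h.perm _, rfl⟩⟩
  · rintro ⟨h3, h4⟩
    exact ⟨⟨_, _, h1, h, h3⟩, ⟨_, _, h2, h.perm _, h4⟩⟩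

theorem HasType.mul {a b : ThetaExpr m r} {Q₁ Q₂ : MvPolynomial (Var m r) ℚ} (ha : a.HasType Q₁)
    (hb : b.HasType Q₂) : (ThetaExpr.mul a b).HasType (Q₁ + Q₂) :=
  ⟨_, _, ha, hb, rfl⟩

theorem hasType_listProd {ι : Type*} (l : List ι) (e : ι → ThetaExpr m r)
    (Q : ι → MvPolynomial (Var m r) ℚ) (h : ∀ i ∈ l, (e i).HasType (Q i)) :
    (listProd (l.map e)).HasType (l.map Q).sum := by
  induction l with
  | nil => exact rfl
  | cons i l ih =>
    exact ⟨_, _, h i List.mem_cons_self, ih fun j hj => h j (List.mem_cons_of_mem _ hj), rfl⟩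

end ThetaExpr

/-! ### Sections of line bundles -/

/-- The sign (-1)^k is kept as an exponential so that it can be merged with the other exponents of
the multiplier. -/
theorem theta_add_int {τ : ℂ} (hτ : 0 < τ.im) (x : ℂ) (k : ℤ) :
    theta τ (x + k) = Complex.exp (Real.pi * Complex.I * k) * theta τ x := by
  have hstep : ∀ x, theta τ (x + 1) = Complex.exp (Real.pi * Complex.I) * theta τ x := fun x => by
    rw [theta_add_one hτ, Complex.exp_pi_mul_I]; ring
  induction k using Int.induction_on generalizing x with
  | zero => simp
  | succ i ih =>
    push_cast at ih ⊢
    rw [← add_assoc, hstep, ih, ← mul_assoc, ← Complex.exp_add]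
    congr 2; ring
  | pred i ih =>
    have h := hstep (x + (-(i : ℤ) - 1 : ℤ))
    rw [show x + (-(i : ℤ) - 1 : ℤ) + 1 = x + (-(i : ℤ) : ℤ) by push_cast; ring, ih] at h
    rw [← mul_right_inj' (Complex.exp_ne_zero (Real.pi * Complex.I)), ← h, ← mul_assoc,
      ← Complex.exp_add]
    congr 2; push_cast; ring

theorem theta_add_int_mul_tau {τ : ℂ} (hτ : 0 < τ.im) (x : ℂ) (l : ℤ) :
    theta τ (x + l * τ) = Complex.exp (Real.pi * Complex.I * l - Real.pi * Complex.I * l ^ 2 * τ -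
      2 * Real.pi * Complex.I * l * x) * theta τ x := by
  have hstep : ∀ x, theta τ (x + τ) = Complex.exp (Real.pi * Complex.I -
      Real.pi * Complex.I * τ - 2 * Real.pi * Complex.I * x) * theta τ x := fun x => by
    rw [theta_add_tau hτ, ← neg_one_mul (Complex.exp _), ← Complex.exp_pi_mul_I, ← Complex.exp_add]
    congr 2; ring
  induction l using Int.induction_on generalizing x with
  | zero => simp
  | succ i ih =>
    push_cast at ih ⊢
    rw [add_mul, one_mul, ← add_assoc, hstep, ih, ← mul_assoc, ← Complex.exp_add]
    congr 2; ring
  | pred i ih =>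
    have h := hstep (x + (-(i : ℤ) - 1 : ℤ) * τ)
    rw [show x + (-(i : ℤ) - 1 : ℤ) * τ + τ = x + (-(i : ℤ) : ℤ) * τ by push_cast; ring, ih] at h
    rw [← mul_right_inj' (Complex.exp_ne_zero _), ← h, ← mul_assoc, ← Complex.exp_add]
    congr 2; push_cast; ring

/-- Since k² - k is even, the sign linear in k that θ produces equals the quadratic one in the
definition of a section. -/
theorem exp_pi_mul_int_sq (k : ℤ) :
    Complex.exp (Real.pi * Complex.I * k ^ 2) = Complex.exp (Real.pi * Complex.I * k) := by
  obtain ⟨n, hn⟩ := Int.even_mul_pred_self k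
  rw [Complex.exp_eq_exp_iff_exists_int]
  refine ⟨n, ?_⟩
  have : (k : ℂ) * (k - 1) = n + n := by exact_mod_cast hn
  linear_combination Real.pi * Complex.I * this

theorem isSection_theta {τ : ℂ} (hτ : 0 < τ.im) (L : Character m r) :
    IsSection τ (fun p => theta τ (L.value p)) (MvPolynomial.C (1 / 2) * L.toPoly ^ 2) := by
  intro k l z
  have hq : ∀ p, qval (MvPolynomial.C (1 / 2) * L.toPoly ^ 2) p = 1 / 2 * L.value p ^ 2 := by
    intro p
    rw [← qval_toPoly]
    simp [qval]
  obtain ⟨K, hK⟩ : ∃ K : ℤ, L.value (fun v => (k v : ℂ)) = K :=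
    ⟨∑ v, L v * k v, by simp [Character.value]⟩
  obtain ⟨N, hN⟩ : ∃ N : ℤ, L.value (fun v => (l v : ℂ)) = N :=
    ⟨∑ v, L v * l v, by simp [Character.value]⟩
  have e1 : L.value (fun v => z v + k v + l v * τ) = L.value z + K + N * τ := by
    rw [← hK, ← hN]
    simp [Character.value, mul_add, Finset.sum_add_distrib, Finset.sum_mul, mul_assoc]
  have e2 : L.value (fun v => l v + z v) = N + L.value z := by
    rw [← hN]
    simp [Character.value, mul_add, Finset.sum_add_distrib]
  dsimp only
  rw [hq, hq, hq, hq, hK, hN, e1, e2, theta_add_int_mul_tau hτ, theta_add_int hτ, ← mul_assoc]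
  congr 1
  have h1 := exp_pi_mul_int_sq K
  have h2 := exp_pi_mul_int_sq N
  -- The cross term arises because the shift by Nτ takes place at L(z) + K; it is an integral
  -- multiple of 2πi.
  have h3 : Complex.exp (-(2 * Real.pi * Complex.I * N * K)) = 1 := by
    rw [Complex.exp_eq_one_iff]
    exact ⟨-(N * K), by push_cast; ring⟩
  calc _ = Complex.exp (Real.pi * Complex.I * N) * Complex.exp (Real.pi * Complex.I * K) *
        Complex.exp (-(2 * Real.pi * Complex.I * N * K)) * Complex.exp (-(Real.pi * Complex.I *
          N ^ 2 * τ) - 2 * Real.pi * Complex.I * N * L.value z) := by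
        rw [← Complex.exp_add, ← Complex.exp_add, ← Complex.exp_add, ← Complex.exp_add]
        congr 1; ring
    _ = _ := by
        rw [← h1, ← h2, h3, mul_one, ← Complex.exp_add, ← Complex.exp_add]
        congr 1; ring

/-- The exponent of the multiplier is linear in Q, so multipliers multiply and invert as types add
and change sign. With the convention 0⁻¹ = 0 the law holds at every point, poles included. -/
theorem ThetaExpr.HasType.isSection {τ : ℂ} (hτ : 0 < τ.im) {e : ThetaExpr m r}
    {Q : MvPolynomial (Var m r) ℚ} (h : e.HasType Q) : IsSection τ (e.eval τ) Q := by
  induction e generalizing Q with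
  | const c =>
    obtain rfl : Q = 0 := h
    intro k l z
    simp [eval, qval]
  | theta L =>
    obtain rfl := h
    exact isSection_theta hτ L
  | thetaInv L =>
    obtain rfl := h
    intro k l z
    have := isSection_theta hτ L k l z
    dsimp only at this
    simp only [eval]
    rw [this, mul_inv, ← Complex.exp_neg]
    congr 2
    simp only [qval, map_neg]
    ring
  | mul a b iha ihb =>
    obtain ⟨Q₁, Q₂, h1, h2, rfl⟩ := h
    intro k l z
    simp only [eval]
    rw [iha h1 k l z, ihb h2 k l z, mul_mul_mul_comm, ← Complex.exp_add]
    congr 2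
    simp only [qval, map_add]
    ring
  | add a b iha ihb =>
    intro k l z
    simp only [eval]
    rw [iha h.1 k l z, ihb h.2 k l z, mul_add]

/-! ### Polynomials not involving the variables `x_i` -/

/-- Membership in a subalgebra makes closure under sums and products available. -/
theorem freeOfX_iff {Q : MvPolynomial (Var m r) ℚ} :
    FreeOfX Q ↔ Q ∈ MvPolynomial.supported ℚ (Set.range (Var.x : Fin m → Var m r))ᶜ := by
  rw [MvPolynomial.mem_supported, Set.subset_compl_iff_disjoint_right, Set.disjoint_right]
  simp [FreeOfX]

theorem FreeOfX.rename_eq {Q : MvPolynomial (Var m r) ℚ} (h : FreeOfX Q)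
    (w : Equiv.Perm (Fin m)) : MvPolynomial.rename (permVar w) Q = Q := by
  have := MvPolynomial.hom_congr_vars (f₁ := (MvPolynomial.rename (R := ℚ)
    (permVar w : Var m r → Var m r)).toRingHom) (f₂ := RingHom.id _) (p₁ := Q) (p₂ := Q)
    (by ext; simp) (fun v hv _ => by
      cases v with
      | x i => exact absurd hv (h i)
      | u => simp [permVar]
      | h => simp [permVar]
      | mu j => simp [permVar]) rfl
  exact this

theorem X_mem_supported_of_ne {v : Var m r} (hv : ∀ i, v ≠ Var.x i) :
    (MvPolynomial.X v : MvPolynomial (Var m r) ℚ) ∈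
      MvPolynomial.supported ℚ (Set.range (Var.x : Fin m → Var m r))ᶜ :=
  MvPolynomial.X_mem_supported.2 fun ⟨i, hi⟩ => hv i hi.symm

theorem Character.IsParameter.freeOfX {L : Character m r} (hL : L.IsParameter) :
    FreeOfX L.toPoly := by
  rw [freeOfX_iff]
  refine Subalgebra.sum_mem _ fun v _ => ?_
  by_cases hv : ∀ i, v ≠ Var.x i
  · exact Subalgebra.mul_mem _ (Subalgebra.algebraMap_mem _ (L v : ℚ)) (X_mem_supported_of_ne hv)
  · push Not at hv
    obtain ⟨i, rfl⟩ := hv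
    simp [hL.1 i]

/-! ### The types `w(q_x) + ρ_m h + q_μ` -/

/-- The quadratic form `∑ α_i x_{w(i)} + ρ_m h + q`. -/
noncomputable def twistedType (α : Fin m → MvPolynomial (Var m r) ℚ)
    (q : MvPolynomial (Var m r) ℚ) (w : Equiv.Perm (Fin m)) : MvPolynomial (Var m r) ℚ :=
  ∑ i, α i * MvPolynomial.X (Var.x (w i)) + rho m r * MvPolynomial.X Var.h + q

/-- Only the terms at i and i + 1 change. This is applied both to q_x and to ρ_m. -/
theorem sum_mul_simpleRefl {R : Type*} [CommRing R] (i : Fin (m - 1)) (a y : Fin m → R) :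
    ∑ k, a k * y (simpleRefl i k) =
      ∑ k, a k * y k + (a (lowIdx i) - a (highIdx i)) * (y (highIdx i) - y (lowIdx i)) := by
  rw [← sub_eq_iff_eq_add', ← Finset.sum_sub_distrib,
    Finset.sum_eq_add (lowIdx i) (highIdx i) (lowIdx_ne_highIdx i)]
  · simp only [simpleRefl, Equiv.swap_apply_left, Equiv.swap_apply_right]
    ring
  · intro k _ hk
    rw [simpleRefl, Equiv.swap_apply_of_ne_of_ne hk.1 hk.2, sub_self]
  · simp
  · simp

theorem twistedType_simpleRefl_mul (α : Fin m → MvPolynomial (Var m r) ℚ)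
    (q : MvPolynomial (Var m r) ℚ) (w : Equiv.Perm (Fin m)) (i : Fin (m - 1)) :
    twistedType α q (simpleRefl i * w) = twistedType α q w +
      (α (w⁻¹ (lowIdx i)) - α (w⁻¹ (highIdx i))) *
        (MvPolynomial.X (Var.x (highIdx i)) - MvPolynomial.X (Var.x (lowIdx i))) := by
  have h := sum_mul_simpleRefl i (fun k => α (w⁻¹ k)) fun k => MvPolynomial.X (R := ℚ) (Var.x k)
  have e : ∀ g : Fin m → Fin m, ∑ k, α k * MvPolynomial.X (Var.x (g (w k))) =
      ∑ k, α (w⁻¹ k) * MvPolynomial.X (Var.x (g k)) := fun g => by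
    rw [← Equiv.sum_comp w fun k => α (w⁻¹ k) * MvPolynomial.X (Var.x (g k))]
    simp
  have e1 := e fun k => simpleRefl i k
  have e2 := e id
  simp only [id] at e2
  simp only [twistedType, Equiv.Perm.mul_apply, e1, e2, h]
  ring

/-- Consecutive coefficients of ρ_m differ by one, so s_i ρ_m - ρ_m = x_{i+1} - x_i, and multiplied
by h this cancels the type of δ(x_i/x_{i+1}, h). This is why ρ_m h stays fixed under all operations.
-/
theorem rename_twistedType {α : Fin m → MvPolynomial (Var m r) ℚ}
    {q : MvPolynomial (Var m r) ℚ} (hα : ∀ i, FreeOfX (α i)) (hq : FreeOfX q)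
    (w : Equiv.Perm (Fin m)) (i : Fin (m - 1)) :
    (MvPolynomial.X (Var.x (lowIdx i)) - MvPolynomial.X (Var.x (highIdx i))) *
        MvPolynomial.X Var.h + MvPolynomial.rename (permVar (simpleRefl i)) (twistedType α q w) =
      twistedType α q (simpleRefl i * w) := by
  have h := sum_mul_simpleRefl i
    (fun k => (MvPolynomial.C ((k.1 : ℚ) + 1) : MvPolynomial (Var m r) ℚ))
    fun k => MvPolynomial.X (Var.x k)
  have e : (MvPolynomial.C (((lowIdx i).1 : ℚ) + 1) : MvPolynomial (Var m r) ℚ) -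
      MvPolynomial.C (((highIdx i).1 : ℚ) + 1) = -1 := by
    rw [← MvPolynomial.C_sub, ← MvPolynomial.C_1, ← MvPolynomial.C_neg]
    simp [lowIdx, highIdx]
  rw [e] at h
  have hρ : MvPolynomial.rename (permVar (simpleRefl i)) (rho m r) = rho m r +
      (MvPolynomial.X (Var.x (highIdx i)) - MvPolynomial.X (Var.x (lowIdx i))) := by
    simp only [rho, map_neg, map_sum, map_mul, MvPolynomial.rename_X, MvPolynomial.rename_C,
      permVar, h]
    ring
  simp only [twistedType, map_add, map_sum, map_mul, (hα _).rename_eq, hq.rename_eq,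
    MvPolynomial.rename_X, permVar, hρ, Equiv.Perm.mul_apply]
  ring

/-- The second summand of the operation forces the type Q. Equality with the first then forces ν,
after cancelling the nonzero polynomial x_{i+1} - x_i. -/
theorem hasType_demazure_twistedType_iff {e : ThetaExpr m r} {α : Fin m → MvPolynomial (Var m r) ℚ}
    {q : MvPolynomial (Var m r) ℚ} (hα : ∀ i, FreeOfX (α i)) (hq : FreeOfX q)
    {w : Equiv.Perm (Fin m)} (he : e.HasType (twistedType α q w)) (τ : ℂ) (i : Fin (m - 1))
    (ν : Character m r) (Q : MvPolynomial (Var m r) ℚ) :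
    (e.demazure τ i ν).HasType Q ↔
      Q = twistedType α q (simpleRefl i * w) ∧
        ν.toPoly = α (w⁻¹ (lowIdx i)) - α (w⁻¹ (highIdx i)) := by
  rw [ThetaExpr.hasType_demazure_iff τ i ν he, rename_twistedType hα hq, and_comm]
  refine and_congr_right fun hQ => ?_
  have hX : (MvPolynomial.X (Var.x (highIdx i)) - MvPolynomial.X (Var.x (lowIdx i)) :
      MvPolynomial (Var m r) ℚ) ≠ 0 := by
    rw [sub_ne_zero]
    intro h0
    have := MvPolynomial.X_injective h0
    exact lowIdx_ne_highIdx i (by simpa using this.symm)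
  rw [hQ, twistedType_simpleRefl_mul, add_comm (twistedType α q w), add_left_inj, mul_comm,
    mul_right_inj' hX, eq_comm]

theorem ThetaExpr.Admissible.hasType {τ : ℂ} {e : ThetaExpr m r}
    {α : Fin m → MvPolynomial (Var m r) ℚ} {q : MvPolynomial (Var m r) ℚ}
    (hα : ∀ i, FreeOfX (α i)) (hq : FreeOfX q) (he : e.HasType (twistedType α q 1))
    {l : List (Fin (m - 1))} {ν : List (Character m r)} (h : Admissible τ l ν e) :
    (demazureWord τ l ν e).HasType (twistedType α q (wordProd l)) := by
  induction l generalizing ν with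
  | nil =>
    cases ν with
    | nil => exact he
    | cons _ _ => exact h.elim
  | cons i l ih =>
    cases ν with
    | nil => exact h.elim
    | cons χ ν =>
      obtain ⟨h1, -, Q, hQ⟩ := h
      have := ((hasType_demazure_twistedType_iff hα hq (ih h1) τ i χ Q).1 hQ).1
      rw [this] at hQ
      simpa [wordProd] using hQ

/-! ### The type of the elliptic class of the minimal link pattern -/

/-- The coefficient `α_i` of `x_i` in the type of the elliptic class of the minimal link
pattern, after removing `ρ_m h`. -/
noncomputable def alphaChar (hmr : 2 * r ≤ m) (i : Fin m) : Character m r :=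
  ∑ k : Fin r,
      ((if targetIdx hmr k = i then
          coord (Var.mu k) + ∑ j : Fin m, if sourceIdx hmr k < j then coord Var.h else 0 else 0) -
        (if sourceIdx hmr k = i then coord (Var.mu k) else 0) -
        (if sourceIdx hmr k < i then coord Var.h else 0)) +
    ((i.1 : ℤ) + 1) • coord Var.h

/-- The part of the type of the elliptic class of the minimal link pattern that does not involve
the variables `x_i`. -/
noncomputable def ellMinConst (hmr : 2 * r ≤ m) : MvPolynomial (Var m r) ℚ :=
  ∑ k : Fin r, (MvPolynomial.X Var.u * MvPolynomial.X (Var.mu k) +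
    ∑ j : Fin m, if sourceIdx hmr k < j then MvPolynomial.X Var.u * MvPolynomial.X Var.h else 0)

/-- The map `Character.toPoly` as a homomorphism. -/
noncomputable def toPolyHom (m r : ℕ) : Character m r →+ MvPolynomial (Var m r) ℚ :=
  AddMonoidHom.mk' Character.toPoly toPoly_add

theorem toPoly_alphaChar (hmr : 2 * r ≤ m) (i : Fin m) :
    (alphaChar hmr i).toPoly = ∑ k : Fin r,
      ((if targetIdx hmr k = i then MvPolynomial.X (Var.mu k) +
          ∑ j : Fin m, if sourceIdx hmr k < j then MvPolynomial.X Var.h else 0 else 0) -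
        (if sourceIdx hmr k = i then MvPolynomial.X (Var.mu k) else 0) -
        (if sourceIdx hmr k < i then MvPolynomial.X Var.h else 0)) +
    MvPolynomial.C ((i.1 : ℚ) + 1) * MvPolynomial.X Var.h := by
  have h : ∀ v : Var m r, toPolyHom m r (coord v) = MvPolynomial.X v := toPoly_coord
  change toPolyHom m r (alphaChar hmr i) = _
  have e : (((i.1 : ℤ) + 1) • MvPolynomial.X Var.h : MvPolynomial (Var m r) ℚ) =
      MvPolynomial.C ((i.1 : ℚ) + 1) * MvPolynomial.X Var.h := by
    rw [zsmul_eq_mul]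
    simp
  simp only [alphaChar, map_add, map_sum, map_sub, map_zsmul, apply_ite (toPolyHom m r), map_zero,
    h, e]

theorem isParameter_coord {v : Var m r} (hx : ∀ i, v ≠ Var.x i) (hu : v ≠ Var.u) :
    (coord v).IsParameter :=
  ⟨fun i => Pi.single_eq_of_ne (hx i).symm _, Pi.single_eq_of_ne hu.symm _⟩

/-- The characters in the variables `h, μ_1, …, μ_r`. -/
def parameterSubgroup (m r : ℕ) : AddSubgroup (Character m r) where
  carrier := {L | L.IsParameter}
  zero_mem' := ⟨fun _ => rfl, rfl⟩
  add_mem' ha hb := ⟨fun i => by simp [ha.1 i, hb.1 i], by simp [ha.2, hb.2]⟩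
  neg_mem' ha := ⟨fun i => by simp [ha.1 i], by simp [ha.2]⟩

theorem isParameter_alphaChar (hmr : 2 * r ≤ m) (i : Fin m) : (alphaChar hmr i).IsParameter := by
  have hh : coord Var.h ∈ parameterSubgroup m r := isParameter_coord (by simp) (by simp)
  have hmu : ∀ k, coord (Var.mu k) ∈ parameterSubgroup m r :=
    fun k => isParameter_coord (by simp) (by simp)
  have hite : ∀ (c : Prop) [Decidable c] (L : Character m r), L ∈ parameterSubgroup m r →
      (if c then L else 0) ∈ parameterSubgroup m r := fun c _ L hL => by
    split_ifs
    · exact hL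
    · exact zero_mem _
  change alphaChar hmr i ∈ parameterSubgroup m r
  refine add_mem (sum_mem fun k _ => sub_mem (sub_mem (hite _ _ (add_mem (hmu k)
    (sum_mem fun j _ => hite _ _ hh))) (hite _ _ (hmu k))) (hite _ _ hh)) (zsmul_mem hh _)

theorem freeOfX_ellMinConst (hmr : 2 * r ≤ m) : FreeOfX (ellMinConst hmr) := by
  rw [freeOfX_iff]
  have hX : ∀ v : Var m r, (∀ i, v ≠ Var.x i) → (MvPolynomial.X v : MvPolynomial (Var m r) ℚ) ∈
      MvPolynomial.supported ℚ (Set.range (Var.x : Fin m → Var m r))ᶜ :=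
    fun v => X_mem_supported_of_ne
  refine Subalgebra.sum_mem _ fun k _ => Subalgebra.add_mem _
    (Subalgebra.mul_mem _ (hX _ (by simp)) (hX _ (by simp))) (Subalgebra.sum_mem _ fun j _ => ?_)
  split_ifs
  · exact Subalgebra.mul_mem _ (hX _ (by simp)) (hX _ (by simp))
  · exact Subalgebra.zero_mem _

theorem sum_map_filter_eq_sum_map_ite {ι M : Type*} [AddCommMonoid M] (l : List ι) (p : ι → Prop)
    [DecidablePred p] (f : ι → M) :
    ((l.filter (fun i => p i)).map f).sum = (l.map fun i => if p i then f i else 0).sum := by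
  induction l with
  | nil => rfl
  | cons i l ih =>
    by_cases h : p i <;> simp [h, ih]

/-- The factors δ contribute Σ_k ((u + x_k - x_{m-r+k})μ_k + Σ_{j > m-r+k} (u + x_k - x_j)h); it
remains to collect the coefficient of each x_i. -/
theorem hasType_ellMin (τ : ℂ) (hmr : 2 * r ≤ m) :
    (ellMin τ hmr).HasType
      (twistedType (fun i => (alphaChar hmr i).toPoly) (ellMinConst hmr) 1) := by
  have h := ThetaExpr.hasType_listProd (List.finRange r) _ _ fun i _ =>
    ThetaExpr.HasType.mul (ThetaExpr.hasType_delta τ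
        (coord Var.u + coord (Var.x (targetIdx hmr i)) - coord (Var.x (sourceIdx hmr i)))
        (coord (Var.mu i)))
      (ThetaExpr.hasType_listProd ((List.finRange m).filter fun j => sourceIdx hmr i < j) _ _
        fun j _ => ThetaExpr.hasType_delta τ
          (coord Var.u + coord (Var.x (targetIdx hmr i)) - coord (Var.x j)) (coord Var.h))
  convert! h using 1
  simp only [sum_map_filter_eq_sum_map_ite, ← Fin.sum_univ_def, toPoly_sub, toPoly_add,
    toPoly_coord, twistedType, toPoly_alphaChar, ellMinConst, rho, Equiv.Perm.one_apply]
  have e1 : ∀ k : Fin r, ∑ i : Fin m, (if targetIdx hmr k = i then MvPolynomial.X (Var.mu k) +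
      ∑ j : Fin m, if sourceIdx hmr k < j then MvPolynomial.X Var.h else 0 else 0) *
        (MvPolynomial.X (Var.x i) : MvPolynomial (Var m r) ℚ) =
      (MvPolynomial.X (Var.mu k) + ∑ j : Fin m, if sourceIdx hmr k < j then MvPolynomial.X Var.h
        else 0) * MvPolynomial.X (Var.x (targetIdx hmr k)) := fun k => by
    simp [ite_mul]
  have e2 : ∀ k : Fin r, ∑ i : Fin m, (if sourceIdx hmr k = i then MvPolynomial.X (Var.mu k)
      else 0) * (MvPolynomial.X (Var.x i) : MvPolynomial (Var m r) ℚ) =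
      MvPolynomial.X (Var.mu k) * MvPolynomial.X (Var.x (sourceIdx hmr k)) := fun k => by
    simp [ite_mul]
  have e3 : ∀ k : Fin r, ∑ j : Fin m, (if sourceIdx hmr k < j then
        (MvPolynomial.X Var.u + MvPolynomial.X (Var.x (targetIdx hmr k)) -
          MvPolynomial.X (Var.x j)) * MvPolynomial.X Var.h else 0) =
      ∑ j : Fin m, (if sourceIdx hmr k < j then MvPolynomial.X Var.u * MvPolynomial.X Var.h
        else 0) + (∑ j : Fin m, if sourceIdx hmr k < j then MvPolynomial.X Var.h else 0) *
          MvPolynomial.X (Var.x (targetIdx hmr k)) -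
      ∑ j : Fin m, (if sourceIdx hmr k < j then MvPolynomial.X Var.h else 0) *
        (MvPolynomial.X (Var.x j) : MvPolynomial (Var m r) ℚ) := fun k => by
    rw [Finset.sum_mul, ← Finset.sum_add_distrib, ← Finset.sum_sub_distrib]
    refine Finset.sum_congr rfl fun j _ => ?_
    split_ifs <;> ring
  have e4 : ∀ (a b c : Fin r → Fin m → MvPolynomial (Var m r) ℚ)
      (d y : Fin m → MvPolynomial (Var m r) ℚ),
      ∑ i, (∑ k, (a k i - b k i - c k i) + d i) * y i =
        ∑ k, (∑ i, a k i * y i - ∑ i, b k i * y i - ∑ i, c k i * y i) + ∑ i, d i * y i := by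
    intro a b c d y
    simp only [← Finset.sum_sub_distrib, add_mul, Finset.sum_add_distrib, Finset.sum_mul]
    rw [Finset.sum_comm]
    simp only [sub_mul]
  have e5 : ∑ i : Fin m, MvPolynomial.C ((i.1 : ℚ) + 1) * MvPolynomial.X Var.h *
        (MvPolynomial.X (Var.x i) : MvPolynomial (Var m r) ℚ) =
      (∑ i : Fin m, MvPolynomial.C ((i.1 : ℚ) + 1) * MvPolynomial.X (Var.x i)) *
        MvPolynomial.X Var.h := by
    rw [Finset.sum_mul]
    exact Finset.sum_congr rfl fun _ _ => by ring
  -- The multiples of h added in `alphaChar` cancel ρ_m h; the rest is compared arrow by arrow.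
  rw [e4, e5, neg_mul, add_neg_cancel_right, ← Finset.sum_add_distrib]
  refine Finset.sum_congr rfl fun k _ => ?_
  rw [e1, e2, e3]
  ring

/-! ### The parameters of the operations -/

theorem coord_mu_apply (k k' : Fin r) :
    (coord (Var.mu k) : Character m r) (Var.mu k') = if k = k' then 1 else 0 := by
  simp [coord, Pi.single_apply, eq_comm]

theorem alphaChar_mu (hmr : 2 * r ≤ m) (i : Fin m) (k : Fin r) :
    alphaChar hmr i (Var.mu k) =
      (if targetIdx hmr k = i then 1 else 0) - (if sourceIdx hmr k = i then 1 else 0) := by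
  have hh : (coord Var.h : Character m r) (Var.mu k) = 0 := by simp [coord]
  have h : ∀ (c : Prop) [Decidable c] (L : Character m r),
      (if c then L else 0) (Var.mu k) = if c then L (Var.mu k) else 0 := fun c _ L => by
    split_ifs <;> rfl
  simp only [alphaChar, Pi.add_apply, Finset.sum_apply, Pi.sub_apply, h, coord_mu_apply, hh,
    Pi.smul_apply, smul_zero, ite_self, Finset.sum_const_zero, add_zero, sub_zero,
    Finset.sum_sub_distrib, ← ite_and]
  congr 1 <;>
  · rw [Finset.sum_eq_single k]
    · simp
    · intro k' _ hk'
      simp [hk']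
    · simp

/-- The sources fill the last r positions, so a vertex without arrow lies to the left of all of
them, and only the correction for ρ_m h contributes. -/
theorem alphaChar_h (hmr : 2 * r ≤ m) {i : Fin m} (ht : ∀ k, targetIdx hmr k ≠ i)
    (hs : ∀ k, sourceIdx hmr k ≠ i) : alphaChar hmr i Var.h = i.1 + 1 := by
  have hlt : ∀ k, ¬sourceIdx hmr k < i := by
    intro k hk
    have hk : m - r + k.1 < i.1 := hk
    have hi := i.2
    exact hs ⟨i.1 - (m - r), by omega⟩ (Fin.ext (by simp [sourceIdx]; omega))
  simp [alphaChar, ht, hs, hlt, coord]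

/-- An end of the k-th arrow is recognized by the coefficient ±1 of μ_k, a vertex without arrow by
the coefficient of h. -/
theorem alphaChar_injective (hmr : 2 * r ≤ m) :
    Function.Injective (alphaChar hmr : Fin m → Character m r) := by
  -- The bound 2r ≤ m separates the first r positions from the last r.
  have hts : ∀ k k', targetIdx hmr k ≠ sourceIdx hmr k' := by
    intro k k' h
    have h : k.1 = m - r + k'.1 := congrArg Fin.val h
    have := k.2
    omega
  have h1 : ∀ k j, alphaChar hmr (targetIdx hmr k) = alphaChar hmr j → targetIdx hmr k = j := by
    intro k j h
    have := congrFun h (Var.mu k)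
    rw [alphaChar_mu, alphaChar_mu, if_pos rfl, if_neg (hts k k).symm] at this
    by_contra hne
    rw [if_neg hne] at this
    split_ifs at this <;> simp at this
  have h2 : ∀ k j, alphaChar hmr (sourceIdx hmr k) = alphaChar hmr j → sourceIdx hmr k = j := by
    intro k j h
    have := congrFun h (Var.mu k)
    rw [alphaChar_mu, alphaChar_mu, if_pos rfl, if_neg (hts k k)] at this
    by_contra hne
    rw [if_neg hne] at this
    split_ifs at this <;> simp at this
  intro i j h
  by_cases hi : (∃ k, targetIdx hmr k = i) ∨ ∃ k, sourceIdx hmr k = i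
  · rcases hi with ⟨k, rfl⟩ | ⟨k, rfl⟩
    exacts [h1 k j h, h2 k j h]
  by_cases hj : (∃ k, targetIdx hmr k = j) ∨ ∃ k, sourceIdx hmr k = j
  · rcases hj with ⟨k, rfl⟩ | ⟨k, rfl⟩
    exacts [(h1 k i h.symm).symm, (h2 k i h.symm).symm]
  push Not at hi hj
  have := congrFun h Var.h
  rw [alphaChar_h hmr hi.1 hi.2, alphaChar_h hmr hj.1 hj.2] at this
  exact Fin.ext (by omega)

/-- The parameter of `C_i` when it is applied after the operation of the permutation `w`. -/
noncomputable def stepParameter (hmr : 2 * r ≤ m) (w : Equiv.Perm (Fin m)) (i : Fin (m - 1)) :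
    Character m r :=
  alphaChar hmr (w⁻¹ (lowIdx i)) - alphaChar hmr (w⁻¹ (highIdx i))

/-- The parameters belonging to a word. -/
noncomputable def wordParameters (hmr : 2 * r ≤ m) : List (Fin (m - 1)) → List (Character m r)
  | [] => []
  | i :: l => stepParameter hmr (wordProd l) i :: wordParameters hmr l

theorem alphaChar_sub_ne_zero (hmr : 2 * r ≤ m) {i j : Fin m} (h : i ≠ j) :
    alphaChar hmr i - alphaChar hmr j ≠ (0 : Character m r) :=
  sub_ne_zero.2 ((alphaChar_injective hmr).ne h)

theorem isParameter_alphaChar_sub (hmr : 2 * r ≤ m) (i j : Fin m) :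
    (alphaChar hmr i - alphaChar hmr j : Character m r).IsParameter :=
  (parameterSubgroup m r).sub_mem (isParameter_alphaChar hmr i) (isParameter_alphaChar hmr j)

theorem stepParameter_ne_zero (hmr : 2 * r ≤ m) (w : Equiv.Perm (Fin m)) (i : Fin (m - 1)) :
    (stepParameter hmr w i : Character m r) ≠ 0 :=
  alphaChar_sub_ne_zero hmr (w⁻¹.injective.ne (lowIdx_ne_highIdx i))

theorem isParameter_stepParameter (hmr : 2 * r ≤ m) (w : Equiv.Perm (Fin m)) (i : Fin (m - 1)) :
    (stepParameter hmr w i : Character m r).IsParameter :=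
  isParameter_alphaChar_sub hmr _ _

theorem ne_zero_of_mem_wordParameters (hmr : 2 * r ≤ m) (l : List (Fin (m - 1)))
    {χ : Character m r} (h : χ ∈ wordParameters hmr l) : χ ≠ 0 := by
  induction l with
  | nil => simp [wordParameters] at h
  | cons i l ih =>
    rcases List.mem_cons.1 h with rfl | h
    exacts [stepParameter_ne_zero hmr _ i, ih h]

/-- Once the tail of the parameters is fixed, its type is known, and purity of the next combination
is an equation for χ with exactly one solution. -/
theorem admissible_ellMin_iff (τ : ℂ) (hmr : 2 * r ≤ m) (l : List (Fin (m - 1)))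
    (ν : List (Character m r)) :
    ThetaExpr.Admissible τ l ν (ellMin τ hmr) ↔ ν = wordParameters hmr l := by
  have hα : ∀ i, FreeOfX ((alphaChar hmr i).toPoly : MvPolynomial (Var m r) ℚ) :=
    fun i => (isParameter_alphaChar hmr i).freeOfX
  induction l generalizing ν with
  | nil => cases ν <;> simp [ThetaExpr.Admissible, wordParameters]
  | cons i l ih =>
    cases ν with
    | nil => simp [ThetaExpr.Admissible, wordParameters]
    | cons χ ν =>
      rw [ThetaExpr.Admissible, wordParameters, List.cons.injEq, and_comm (a := χ = _)]
      refine (and_congr_left' (ih ν)).trans (and_congr_right fun hν => ?_)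
      have ht := ((ih ν).2 hν).hasType hα (freeOfX_ellMinConst hmr) (hasType_ellMin τ hmr)
      have key := hasType_demazure_twistedType_iff hα (freeOfX_ellMinConst hmr) ht τ i χ
      simp only [← toPoly_sub, toPoly_injective.eq_iff] at key
      constructor
      · rintro ⟨-, Q, hQ⟩
        exact ((key Q).1 hQ).2
      · rintro rfl
        exact ⟨isParameter_stepParameter hmr _ i, _, (key _).2 ⟨rfl, rfl⟩⟩

theorem isNonsingular_demazureWord (τ : ℂ) (hmr : 2 * r ≤ m) (l : List (Fin (m - 1))) :
    (ThetaExpr.demazureWord τ l (wordParameters hmr l)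
      (ellMin τ hmr : ThetaExpr m r)).IsNonsingular := by
  induction l with
  | nil => exact isNonsingular_ellMin τ hmr
  | cons i l ih => exact ih.demazure τ i (stepParameter_ne_zero hmr _ i)

/-! ### Reduced words in the symmetric group -/

/-- The inversions of `w⁻¹`. -/
def inversions (w : Equiv.Perm (Fin m)) : Finset (Fin m × Fin m) :=
  {a | a.1 < a.2 ∧ w⁻¹ a.2 < w⁻¹ a.1}

theorem mem_inversions {w : Equiv.Perm (Fin m)} {a : Fin m × Fin m} :
    a ∈ inversions w ↔ a.1 < a.2 ∧ w⁻¹ a.2 < w⁻¹ a.1 := by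
  simp [inversions]

theorem simpleRefl_mul_self (i : Fin (m - 1)) : simpleRefl i * simpleRefl i = 1 :=
  Equiv.swap_mul_self _ _

theorem simpleRefl_apply_self (i : Fin (m - 1)) (a : Fin m) :
    simpleRefl i (simpleRefl i a) = a :=
  Equiv.swap_apply_self _ _ _

theorem simpleRefl_mul_cancel (i : Fin (m - 1)) (w : Equiv.Perm (Fin m)) :
    simpleRefl i * (simpleRefl i * w) = w := by
  rw [← mul_assoc, simpleRefl_mul_self, one_mul]

theorem inv_simpleRefl_mul_apply (i : Fin (m - 1)) (w : Equiv.Perm (Fin m)) (a : Fin m) :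
    (simpleRefl i * w)⁻¹ a = w⁻¹ (simpleRefl i a) := by
  rw [mul_inv_rev, Equiv.Perm.mul_apply, simpleRefl, Equiv.swap_inv]

theorem simpleRefl_lowIdx (i : Fin (m - 1)) : simpleRefl i (lowIdx i) = highIdx i :=
  Equiv.swap_apply_left _ _

theorem simpleRefl_highIdx (i : Fin (m - 1)) : simpleRefl i (highIdx i) = lowIdx i :=
  Equiv.swap_apply_right _ _

theorem lowIdx_lt_highIdx (i : Fin (m - 1)) : lowIdx i < highIdx i :=
  Fin.mk_lt_mk.2 (Nat.lt_succ_self _)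

theorem simpleRefl_of_succ {i j : Fin (m - 1)} (hij : j.1 = i.1 + 1) :
    simpleRefl i (highIdx j) = highIdx j ∧ simpleRefl j (lowIdx i) = lowIdx i := by
  have e := lowIdx_eq_highIdx hij
  have n1 := lowIdx_ne_highIdx_succ hij
  exact ⟨Equiv.swap_apply_of_ne_of_ne n1.symm (e ▸ (lowIdx_ne_highIdx j).symm),
    Equiv.swap_apply_of_ne_of_ne (e ▸ lowIdx_ne_highIdx i) n1⟩

theorem simpleRefl_lt {i : Fin (m - 1)} {a b : Fin m} (hab : a < b)
    (hne : ¬(a = lowIdx i ∧ b = highIdx i)) : simpleRefl i a < simpleRefl i b := by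
  simp only [simpleRefl, Equiv.swap_apply_def]
  simp only [Fin.ext_iff, Fin.lt_def, lowIdx, highIdx] at *
  split_ifs <;> (try simp only) <;> omega

/-- Since s_i preserves the order of every pair except (i, i + 1), it maps the inversions of s_i w
other than this pair bijectively onto those of w. -/
theorem card_inversions_simpleRefl_mul {w : Equiv.Perm (Fin m)} {i : Fin (m - 1)}
    (h : w⁻¹ (lowIdx i) < w⁻¹ (highIdx i)) :
    (inversions (simpleRefl i * w)).card = (inversions w).card + 1 := by
  have hmem : (lowIdx i, highIdx i) ∈ inversions (simpleRefl i * w) := by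
    rw [mem_inversions, inv_simpleRefl_mul_apply, inv_simpleRefl_mul_apply]
    dsimp only
    rw [simpleRefl_lowIdx, simpleRefl_highIdx]
    exact ⟨lowIdx_lt_highIdx i, h⟩
  rw [← Finset.card_erase_add_one hmem]
  congr 1
  refine Finset.card_bij' (fun a _ => (simpleRefl i a.1, simpleRefl i a.2))
    (fun a _ => (simpleRefl i a.1, simpleRefl i a.2)) ?_ ?_ ?_ ?_
  · rintro ⟨a, b⟩ hab
    rw [Finset.mem_erase, mem_inversions, inv_simpleRefl_mul_apply, inv_simpleRefl_mul_apply] at hab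
    rw [mem_inversions]
    exact ⟨simpleRefl_lt hab.2.1 fun h => hab.1 (Prod.ext h.1 h.2), hab.2.2⟩
  · rintro ⟨a, b⟩ hab
    rw [mem_inversions] at hab
    rw [Finset.mem_erase, mem_inversions, inv_simpleRefl_mul_apply, inv_simpleRefl_mul_apply]
    dsimp only at hab ⊢
    rw [simpleRefl_apply_self, simpleRefl_apply_self]
    have hne : ¬(a = lowIdx i ∧ b = highIdx i) := by
      rintro ⟨rfl, rfl⟩
      exact lt_asymm h hab.2
    refine ⟨fun h0 => ?_, simpleRefl_lt hab.1 hne, hab.2⟩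
    have h1 := congrArg (simpleRefl i) (Prod.mk.inj h0).1
    have h2 := congrArg (simpleRefl i) (Prod.mk.inj h0).2
    rw [simpleRefl_apply_self, simpleRefl_lowIdx] at h1
    rw [simpleRefl_apply_self, simpleRefl_highIdx] at h2
    rw [h1, h2] at hab
    exact lt_asymm hab.1 (lowIdx_lt_highIdx i)
  · rintro ⟨a, b⟩ _
    simp [simpleRefl_apply_self]
  · rintro ⟨a, b⟩ _
    simp [simpleRefl_apply_self]

theorem card_inversions_simpleRefl_mul_of_descent {w : Equiv.Perm (Fin m)} {i : Fin (m - 1)}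
    (h : w⁻¹ (highIdx i) < w⁻¹ (lowIdx i)) :
    (inversions w).card = (inversions (simpleRefl i * w)).card + 1 := by
  have := card_inversions_simpleRefl_mul (w := simpleRefl i * w) (i := i) (by
    rwa [inv_simpleRefl_mul_apply, inv_simpleRefl_mul_apply, simpleRefl_lowIdx,
      simpleRefl_highIdx])
  rwa [simpleRefl_mul_cancel] at this

theorem ascent_or_descent (w : Equiv.Perm (Fin m)) (i : Fin (m - 1)) :
    w⁻¹ (lowIdx i) < w⁻¹ (highIdx i) ∨ w⁻¹ (highIdx i) < w⁻¹ (lowIdx i) :=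
  lt_or_gt_of_ne (w⁻¹.injective.ne (lowIdx_ne_highIdx i))

/-- A strictly increasing bijection of a finite chain is the identity. -/
theorem eq_one_of_no_descent {w : Equiv.Perm (Fin m)}
    (h : ∀ i, w⁻¹ (lowIdx i) < w⁻¹ (highIdx i)) : w = 1 := by
  cases m with
  | zero => exact Subsingleton.elim _ _
  | succ n =>
    have hmono : StrictMono (⇑(w⁻¹)) :=
      Fin.strictMono_iff_lt_succ.2 fun i => h i
    have := (hmono.range_inj strictMono_id).1 (by
      rw [(w⁻¹).surjective.range_eq, Set.range_id])
    refine inv_eq_one.1 (Equiv.ext fun a => ?_)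
    exact congrFun this a

theorem wordProd_cons (i : Fin (m - 1)) (l : List (Fin (m - 1))) :
    wordProd (i :: l) = simpleRefl i * wordProd l := by
  simp [wordProd]

theorem card_inversions_wordProd_le (l : List (Fin (m - 1))) :
    (inversions (wordProd l)).card ≤ l.length := by
  induction l with
  | nil =>
    have : inversions (wordProd ([] : List (Fin (m - 1)))) = ∅ := by
      ext a
      simp only [mem_inversions, wordProd, List.map_nil, List.prod_nil, inv_one,
        Equiv.Perm.one_apply, Finset.notMem_empty, iff_false, not_and, not_lt]
      exact le_of_lt
    simp [this]
  | cons i l ih =>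
    rw [wordProd_cons, List.length_cons]
    rcases ascent_or_descent (wordProd l) i with h | h
    · rw [card_inversions_simpleRefl_mul h]
      omega
    · have := card_inversions_simpleRefl_mul_of_descent h
      omega

/-- Sorting: as long as w ≠ 1 there is a descent, and removing it lowers the number of inversions by
one. -/
theorem exists_word_length_eq (w : Equiv.Perm (Fin m)) :
    ∃ l, wordProd l = w ∧ l.length = (inversions w).card := by
  induction hn : (inversions w).card generalizing w with
  | zero =>
    refine ⟨[], ?_, rfl⟩
    rw [eq_one_of_no_descent (w := w) fun i => ?_]
    · rfl
    · refine (ascent_or_descent w i).resolve_right fun h => ?_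
      have := card_inversions_simpleRefl_mul_of_descent h
      omega
  | succ n ih =>
    have hex : ∃ i, w⁻¹ (highIdx i) < w⁻¹ (lowIdx i) := by
      by_contra! hcon
      have h1 : w = 1 := eq_one_of_no_descent fun i =>
        (ascent_or_descent w i).resolve_right (hcon i).not_gt
      have := card_inversions_wordProd_le ([] : List (Fin (m - 1)))
      rw [show wordProd ([] : List (Fin (m - 1))) = w from h1.symm, hn] at this
      simp at this
    obtain ⟨i, hi⟩ := hex
    have := card_inversions_simpleRefl_mul_of_descent hi
    obtain ⟨l, hl, hlen⟩ := ih (simpleRefl i * w) (by omega)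
    exact ⟨i :: l, by rw [wordProd_cons, hl, simpleRefl_mul_cancel], by simp [hlen]⟩

theorem isReducedWord_iff {l : List (Fin (m - 1))} {w : Equiv.Perm (Fin m)} :
    IsReducedWord l w ↔ wordProd l = w ∧ l.length = (inversions w).card := by
  refine and_congr_right fun h => ⟨fun hmin => le_antisymm ?_ ?_, fun hlen l' hl' => ?_⟩
  · obtain ⟨l', hl', hlen⟩ := exists_word_length_eq w
    exact hlen ▸ hmin l' hl'
  · exact h ▸ card_inversions_wordProd_le l
  · rw [hlen, ← hl']
    exact card_inversions_wordProd_le l'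

theorem exists_isReducedWord (w : Equiv.Perm (Fin m)) : ∃ l, IsReducedWord l w := by
  obtain ⟨l, hl⟩ := exists_word_length_eq w
  exact ⟨l, isReducedWord_iff.2 hl⟩

/-- If the first letter lowered the number of inversions, the word would be too long for its
permutation. -/
theorem IsReducedWord.of_cons {i : Fin (m - 1)} {l : List (Fin (m - 1))}
    {w : Equiv.Perm (Fin m)} (h : IsReducedWord (i :: l) w) :
    IsReducedWord l (simpleRefl i * w) ∧ w⁻¹ (highIdx i) < w⁻¹ (lowIdx i) := by
  rw [isReducedWord_iff, wordProd_cons, List.length_cons] at h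
  obtain ⟨rfl, hlen⟩ := h
  have hle := card_inversions_wordProd_le l
  rw [isReducedWord_iff, simpleRefl_mul_cancel, inv_simpleRefl_mul_apply, inv_simpleRefl_mul_apply,
    simpleRefl_lowIdx, simpleRefl_highIdx]
  rcases ascent_or_descent (wordProd l) i with hd | hd
  · rw [card_inversions_simpleRefl_mul hd] at hlen
    exact ⟨⟨rfl, by omega⟩, hd⟩
  · have := card_inversions_simpleRefl_mul_of_descent hd
    omega

theorem IsReducedWord.cons {i : Fin (m - 1)} {l : List (Fin (m - 1))}
    {w : Equiv.Perm (Fin m)} (h : IsReducedWord l (simpleRefl i * w))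
    (hd : w⁻¹ (highIdx i) < w⁻¹ (lowIdx i)) : IsReducedWord (i :: l) w := by
  rw [isReducedWord_iff] at h ⊢
  rw [wordProd_cons, h.1, simpleRefl_mul_cancel, List.length_cons, h.2,
    card_inversions_simpleRefl_mul_of_descent hd]
  exact ⟨rfl, rfl⟩

/-- An equivalence relation on words that is compatible with adding a letter on the left and
contains the braid moves at the front relates all reduced words of a permutation (the theorem of
Matsumoto and Tits for the symmetric group). -/
theorem IsReducedWord.induction_braid {R : List (Fin (m - 1)) → List (Fin (m - 1)) → Prop}
    (hrefl : ∀ l, R l l) (hsymm : ∀ l l', R l l' → R l' l)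
    (htrans : ∀ l l' l'', R l l' → R l' l'' → R l l'')
    (hcons : ∀ i l l', wordProd l = wordProd l' → R l l' → R (i :: l) (i :: l'))
    (hcomm : ∀ (i j : Fin (m - 1)) l, i.1 + 1 < j.1 → R (i :: j :: l) (j :: i :: l))
    (hbraid : ∀ (i j : Fin (m - 1)) l, j.1 = i.1 + 1 → R (i :: j :: i :: l) (j :: i :: j :: l))
    {l l' : List (Fin (m - 1))} {w : Equiv.Perm (Fin m)} (hl : IsReducedWord l w)
    (hl' : IsReducedWord l' w) : R l l' := by
  induction hn : l.length using Nat.strong_induction_on generalizing l l' w with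
  | _ n ih =>
    have hlen : l.length = l'.length :=
      (isReducedWord_iff.1 hl).2.trans (isReducedWord_iff.1 hl').2.symm
    -- Words with the same first letter: the induction hypothesis applies to their tails.
    have hsame : ∀ {i l₁ l₂}, (i :: l₁).length ≤ n → IsReducedWord (i :: l₁) w →
        IsReducedWord (i :: l₂) w → R (i :: l₁) (i :: l₂) := by
      intro i l₁ l₂ hle h₁ h₂
      have k₁ := h₁.of_cons.1
      have k₂ := h₂.of_cons.1
      exact hcons i l₁ l₂ (k₁.1.trans k₂.1.symm)
        (ih l₁.length (by rw [List.length_cons] at hle; omega) k₁ k₂ rfl)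
    have hred : ∀ {l₁}, IsReducedWord l₁ w → l₁.length ≤ n := fun h₁ =>
      ((isReducedWord_iff.1 h₁).2.trans ((isReducedWord_iff.1 hl).2.symm.trans hn)).le
    -- For different first letters both are descents, so w has two reduced words that begin with the
    -- two words of the longest element of ⟨s_i, s_j⟩ and share the tail l₃. One braid move links
    -- these, and `hsame` links each to a given word.
    have hlt : ∀ {i j : Fin (m - 1)} {l₁ l₂}, i < j → IsReducedWord (i :: l₁) w →
        IsReducedWord (j :: l₂) w → R (i :: l₁) (j :: l₂) := by
      intro i j l₁ l₂ hij h₁ h₂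
      have hi := h₁.of_cons.2
      have hj := h₂.of_cons.2
      rcases (Nat.succ_le_of_lt hij).lt_or_eq with hij | hij
      · obtain ⟨k1, k2, k3, k4⟩ := simpleRefl_of_far hij
        obtain ⟨l₃, h₃⟩ := exists_isReducedWord (simpleRefl j * (simpleRefl i * w))
        have h₃' : IsReducedWord l₃ (simpleRefl i * (simpleRefl j * w)) := by
          rwa [← mul_assoc, simpleRefl_mul_comm hij, mul_assoc]
        have g₁ : IsReducedWord (i :: j :: l₃) w :=
          (h₃.cons (by rwa [inv_simpleRefl_mul_apply, inv_simpleRefl_mul_apply, k1, k2])).cons hi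
        have g₂ : IsReducedWord (j :: i :: l₃) w :=
          (h₃'.cons (by rwa [inv_simpleRefl_mul_apply, inv_simpleRefl_mul_apply, k3, k4])).cons hj
        exact htrans _ _ _ (hsame (hred h₁) h₁ g₁)
          (htrans _ _ _ (hcomm i j l₃ hij) (hsame (hred g₂) g₂ h₂))
      · have hij : j.1 = i.1 + 1 := hij.symm
        obtain ⟨k1, k2⟩ := simpleRefl_of_succ hij
        have e := lowIdx_eq_highIdx hij
        have k3 := simpleRefl_lowIdx j
        have k4 := simpleRefl_highIdx j
        rw [e] at hj k3 k4
        obtain ⟨l₃, h₃⟩ := exists_isReducedWord (simpleRefl i * (simpleRefl j * (simpleRefl i * w)))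
        have h₃' : IsReducedWord l₃ (simpleRefl j * (simpleRefl i * (simpleRefl j * w))) := by
          have hb := simpleRefl_braid hij
          simp only [mul_assoc] at hb
          have : simpleRefl i * (simpleRefl j * (simpleRefl i * w)) =
              simpleRefl j * (simpleRefl i * (simpleRefl j * w)) := by
            simpa only [mul_assoc] using congrArg (· * w) hb
          rwa [← this]
        -- The two descents say that w⁻¹ reverses three consecutive positions, so each of the three
        -- letters removes an inversion.
        have g₁ : IsReducedWord (i :: j :: i :: l₃) w := by
          refine ((h₃.cons ?_).cons ?_).cons hi
          · simpa only [inv_simpleRefl_mul_apply, k1, k2, k3, simpleRefl_lowIdx] using hj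
          · simpa only [inv_simpleRefl_mul_apply, e, k1, simpleRefl_highIdx] using hj.trans hi
        have g₂ : IsReducedWord (j :: i :: j :: l₃) w := by
          refine ((h₃'.cons ?_).cons ?_).cons (by rwa [e])
          · simpa only [inv_simpleRefl_mul_apply, e, k1, k2, k4, simpleRefl_highIdx] using hi
          · simpa only [inv_simpleRefl_mul_apply, k2, k3] using hj.trans hi
        exact htrans _ _ _ (hsame (hred h₁) h₁ g₁)
          (htrans _ _ _ (hbraid i j l₃ hij) (hsame (hred g₂) g₂ h₂))
    match l, l' with
    | [], [] => exact hrefl _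
    | [], _ :: _ => simp at hlen
    | _ :: _, [] => simp at hlen
    | i :: l₁, j :: l₂ =>
      rcases lt_trichotomy i j with hij | rfl | hij
      · exact hlt hij hl hl'
      · exact hsame hn.le hl hl'
      · exact hsymm _ _ (hlt hij hl' hl)

/-! ### Independence of the reduced word -/

theorem meroEq_demazureWord {τ : ℂ} (hτ : 0 < τ.im) (hmr : 2 * r ≤ m)
    (f : (Var m r → ℂ) → ℂ) {l l' : List (Fin (m - 1))} {w : Equiv.Perm (Fin m)}
    (hl : IsReducedWord l w) (hl' : IsReducedWord l' w) :
    MeroEq (demazureWord τ l (wordParameters hmr l) f)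
      (demazureWord τ l' (wordParameters hmr l') f) := by
  refine hl.induction_braid (R := fun l l' => MeroEq (demazureWord τ l (wordParameters hmr l) f)
    (demazureWord τ l' (wordParameters hmr l') f)) (fun l => MeroEq.refl _)
    (fun _ _ => MeroEq.symm) (fun _ _ _ => MeroEq.trans) ?_ ?_ ?_ hl'
  · intro i l l' h hR
    -- The parameter of the first letter depends on the tail only through its permutation.
    simp only [wordParameters, demazureWord, h]
    exact hR.demazure τ i _
  · intro i j l hij
    obtain ⟨h1, h2, h3, h4⟩ := simpleRefl_of_far hij
    have e1 : stepParameter hmr (simpleRefl j * wordProd l) i =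
        (stepParameter hmr (wordProd l) i : Character m r) := by
      simp only [stepParameter, inv_simpleRefl_mul_apply, h3, h4]
    have e2 : stepParameter hmr (simpleRefl i * wordProd l) j =
        (stepParameter hmr (wordProd l) j : Character m r) := by
      simp only [stepParameter, inv_simpleRefl_mul_apply, h1, h2]
    simp only [wordParameters, demazureWord, wordProd_cons, e1, e2]
    rw [demazure_comm τ hij (isParameter_stepParameter hmr _ i) (isParameter_stepParameter hmr _ j)]
    exact MeroEq.refl _
  · intro i j l hij
    obtain ⟨h1, h2⟩ := simpleRefl_of_succ hij
    have e := lowIdx_eq_highIdx hij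
    have n1 := lowIdx_ne_highIdx_succ hij
    have h3 := simpleRefl_lowIdx j
    have h4 := simpleRefl_highIdx j
    rw [e] at h3 h4
    set v := (wordProd l)⁻¹ with hv
    -- Here a = α_{v(i)} - α_{v(i+1)} and b = α_{v(i+1)} - α_{v(i+2)}. The sum telescopes to
    -- α_{v(i)} - α_{v(i+2)}, which is again nonzero because v and α are injective.
    have key := meroEq_demazure_braid hτ hij
      (isParameter_alphaChar_sub hmr (v (lowIdx i)) (v (highIdx i)))
      (isParameter_alphaChar_sub hmr (v (highIdx i)) (v (highIdx j)))
      (alphaChar_sub_ne_zero hmr (v.injective.ne (lowIdx_ne_highIdx i)))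
      (alphaChar_sub_ne_zero hmr (v.injective.ne (e ▸ lowIdx_ne_highIdx j)))
      (by rw [sub_add_sub_cancel]; exact alphaChar_sub_ne_zero hmr (v.injective.ne n1))
      (demazureWord τ l (wordParameters hmr l) f)
    rw [sub_add_sub_cancel] at key
    simpa only [wordParameters, demazureWord, wordProd_cons, stepParameter,
      inv_simpleRefl_mul_apply, simpleRefl_lowIdx, simpleRefl_highIdx, e, h1, h2, h3, h4,
      ← hv] using key

end LinkPattern

/-! ### The main theorem -/

theorem mainTheorem8 (τ : ℂ) (hτ : 0 < τ.im) (m r : ℕ) (hmr : 2 * r ≤ m) :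
    -- the type of the elliptic class of the minimal link pattern is of the form
    -- `q_x + ρ_m h + q_μ` with `q_x = ∑ α_i x_i`
    (∃ (α : Fin m → MvPolynomial (LinkPattern.Var m r) ℚ)
        (qμ : MvPolynomial (LinkPattern.Var m r) ℚ),
      (∀ i, LinkPattern.FreeOfX (α i)) ∧ LinkPattern.FreeOfX qμ ∧
      (LinkPattern.ellMin τ hmr).HasType
        (∑ i, α i * MvPolynomial.X (LinkPattern.Var.x i) +
          LinkPattern.rho m r * MvPolynomial.X LinkPattern.Var.h + qμ)) ∧
    ∀ w : Equiv.Perm (Fin m),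
      -- well defined: the parameters are uniquely determined by purity, none of them is the
      -- trivial character, and the composition is a meromorphic function
      (∀ l : List (Fin (m - 1)), LinkPattern.IsReducedWord l w →
        (∃! ν : List (LinkPattern.Character m r),
          LinkPattern.ThetaExpr.Admissible τ l ν (LinkPattern.ellMin τ hmr)) ∧
        ∀ ν : List (LinkPattern.Character m r),
          LinkPattern.ThetaExpr.Admissible τ l ν (LinkPattern.ellMin τ hmr) →
          (∀ χ ∈ ν, χ ≠ 0) ∧
          LinkPattern.IsMeromorphic
            (LinkPattern.demazureWord τ l ν ((LinkPattern.ellMin τ hmr).eval τ))) ∧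
      -- independence of the reduced word
      (∀ (l l' : List (Fin (m - 1))) (ν ν' : List (LinkPattern.Character m r)),
        LinkPattern.IsReducedWord l w → LinkPattern.IsReducedWord l' w →
        LinkPattern.ThetaExpr.Admissible τ l ν (LinkPattern.ellMin τ hmr) →
        LinkPattern.ThetaExpr.Admissible τ l' ν' (LinkPattern.ellMin τ hmr) →
        LinkPattern.MeroEq
          (LinkPattern.demazureWord τ l ν ((LinkPattern.ellMin τ hmr).eval τ))
          (LinkPattern.demazureWord τ l' ν' ((LinkPattern.ellMin τ hmr).eval τ))) ∧
      -- the type of the composition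
      (∀ (α : Fin m → MvPolynomial (LinkPattern.Var m r) ℚ)
          (qμ : MvPolynomial (LinkPattern.Var m r) ℚ),
        (∀ i, LinkPattern.FreeOfX (α i)) → LinkPattern.FreeOfX qμ →
        (LinkPattern.ellMin τ hmr).HasType
          (∑ i, α i * MvPolynomial.X (LinkPattern.Var.x i) +
            LinkPattern.rho m r * MvPolynomial.X LinkPattern.Var.h + qμ) →
        ∀ (l : List (Fin (m - 1))) (ν : List (LinkPattern.Character m r)),
          LinkPattern.IsReducedWord l w →
          LinkPattern.ThetaExpr.Admissible τ l ν (LinkPattern.ellMin τ hmr) →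
          (LinkPattern.ThetaExpr.demazureWord τ l ν (LinkPattern.ellMin τ hmr)).HasType
            (∑ i, α i * MvPolynomial.X (LinkPattern.Var.x (w i)) +
              LinkPattern.rho m r * MvPolynomial.X LinkPattern.Var.h + qμ) ∧
          LinkPattern.IsSection τ
            (LinkPattern.demazureWord τ l ν ((LinkPattern.ellMin τ hmr).eval τ))
            (∑ i, α i * MvPolynomial.X (LinkPattern.Var.x (w i)) +
              LinkPattern.rho m r * MvPolynomial.X LinkPattern.Var.h + qμ)) := by
  have hα : ∀ i, LinkPattern.FreeOfX (LinkPattern.alphaChar hmr i).toPoly :=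
    fun i => (LinkPattern.isParameter_alphaChar hmr i).freeOfX
  refine ⟨⟨fun i => (LinkPattern.alphaChar hmr i).toPoly, LinkPattern.ellMinConst hmr, hα,
    LinkPattern.freeOfX_ellMinConst hmr, LinkPattern.hasType_ellMin τ hmr⟩, fun w => ⟨?_, ?_, ?_⟩⟩
  · intro l _
    refine ⟨⟨LinkPattern.wordParameters hmr l, (LinkPattern.admissible_ellMin_iff τ hmr l _).2 rfl,
      fun ν => (LinkPattern.admissible_ellMin_iff τ hmr l ν).1⟩, fun ν hν => ?_⟩
    obtain rfl := (LinkPattern.admissible_ellMin_iff τ hmr l ν).1 hν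
    refine ⟨fun χ => LinkPattern.ne_zero_of_mem_wordParameters hmr l, ?_⟩
    rw [← LinkPattern.ThetaExpr.eval_demazureWord]
    exact (LinkPattern.isNonsingular_demazureWord τ hmr l).isMeromorphic hτ
  · intro l l' ν ν' hl hl' hν hν'
    obtain rfl := (LinkPattern.admissible_ellMin_iff τ hmr l ν).1 hν
    obtain rfl := (LinkPattern.admissible_ellMin_iff τ hmr l' ν').1 hν'
    exact LinkPattern.meroEq_demazureWord hτ hmr _ hl hl'
  · intro α q hα hq he l ν hl hν
    have h := hν.hasType hα hq he
    rw [hl.1] at h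
    refine ⟨h, ?_⟩
    rw [← LinkPattern.ThetaExpr.eval_demazureWord]
    exact h.isSection hτ
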